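/- Let $d\ge 0$ and $m,n\ge 1$ be integers. A noncommutative multilinear polynomial in $m$ variables with coefficients in $M_n(\mathbb C)$ is an expression $Q(X_1,\dots,X_m)=\sum_{S\subseteq\{1,\dots,m\}}\widehat Q(S)\prod_{i\in S}X_i$ with $\widehat Q(S)\in M_n(\mathbb C)$ and all products taken in increasing order of the index; its degree is $\max\{|S|:\widehat Q(S)\ne 0\}$ (and $0$ if $Q=0$). For $\sigma\in\{-1,1\}^m$ let $Q(\sigma)=\sum_S\widehat Q(S)\prod_{i\in S}\sigma_i$. For $p\ge n$ let $\iota:M_n(\mathbb C)\to M_p(\mathbb C)$ be the zero-padding embedding $\iota(A)=\begin{pmatrix}A&0\\0&0\end{pmatrix}$, and let $Q^\iota(X_1,\dots,X_m)=\sum_S\iota(\widehat Q(S))\prod_{i\in S}X_i$ for $X_i\in M_p(\mathbb C)$. Write $|A|=(AA^*)^{1/2}$, let $\|A\|$ be the operator norm, let $\mathrm{Inf}_i(Q)=\sum_{S\ni i}\mathrm{Tr}(\widehat Q(S)\widehat Q(S)^*)$ and $\tau=\max_{1\le i\le m}\mathrm{Inf}_i(Q)$, and let $\psi(t)=\max(0,|t|-1)$;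 real functions are applied to Hermitian matrices by functional calculus. There is a function $C:\mathbb N\times\mathbb N\to\mathbb R$ such that the following holds for all $m,n\ge1$ and $p\ge n$, every such $Q$, with degree denoted by $d$, and all $c_2,c_3\ge 1$. Let $G_1,\dots,G_m$ be i.i.d. random matrices in $M_n(\mathbb C)$ with $\mathbb E G_1=0$, $\mathbb E G_1G_1^*=I$, $\|\mathbb E(G_1G_1^*)^2\|\le c_2$ and $\|\mathbb E(G_1G_1^*)^3\|\le c_3$ (all these moments being finite), let $H_1,\dots,H_m$ be i.i.d. Haar-distributed $p\times p$ unitary matrices independent of the $G_i$, and let $b$ be uniformly distributed in $\{-1,1\}^m$. Write $\mathbf Q=Q^\iota(\iota(G_1)H_1,\dots,\iota(G_m)H_m)$. (a) If $\mathbb E_b\frac1n\mathrm{Tr}|Q(b)|^2\le 1$, then $\frac1n\mathrm{Tr}\,\psi(|\mathbf Q|^2)$ is integrable and $$\mathbb E\,\tfrac1n\mathrm{Tr}\,\psi\big(|\mathbf Q|^2\big)\le \mathbb E_b\,\tfrac1n\mathrm{Tr}\,\psi\big(|Q(b)|^2\big)+n^{1/2}(8c_2c_3)^{9d}\tau^{1/6}+C(m,n)\,\tau^{-1/3}p^{-1/2}.$$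 (b) If $\|Q(\sigma)\|\le 1$ for all $\sigma\in\{-1,1\}^m$, then both $\frac1n\mathrm{Tr}\,\psi(|\mathbf Q|^2)$ and $\frac1n\mathrm{Tr}\,\big(\max(0,|\mathbf Q|-1)\big)^2$ are integrable and each has expectation at most $$n^{1/2}(8c_2c_3)^{9d}\tau^{1/6}+C(m,n)\,\tau^{-1/3}p^{-1/2}.$$ If $\tau=0$, the bounds hold with the terms containing $\tau$ read as $0$. -/

import Mathlib

open MeasureTheory
open scoped Matrix Matrix.Norms.L2Operator

noncomputable section

namespace NCMaj

/-- `n × n` complex matrices; the norm in force is the operator norm (largest singular value). -/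
abbrev Mat (n : ℕ) : Type := Matrix (Fin n) (Fin n) ℂ

/-- Matrices carry their Borel σ-algebra. -/
instance instMeasurableSpaceMat (n : ℕ) : MeasurableSpace (Mat n) := borel _

instance instBorelSpaceMat (n : ℕ) : BorelSpace (Mat n) := ⟨rfl⟩

/-- The unitary group of `p × p` complex matrices. -/
abbrev UGroup (p : ℕ) : Type := Matrix.unitaryGroup (Fin p) ℂ

instance instCompactSpaceUGroup (p : ℕ) : CompactSpace (UGroup p) := by
  have hfin : FiniteDimensional ℂ (Mat p) := inferInstance
  have hprop : ProperSpace (Mat p) := FiniteDimensional.proper ℂ (Mat p)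
  refine isCompact_iff_compactSpace.mp (Metric.isCompact_of_isClosed_isBounded ?_ ?_)
  · have h : ((Matrix.unitaryGroup (Fin p) ℂ : Submonoid (Mat p)) : Set (Mat p))
        = {A : Mat p | A * star A = 1} := by
      ext A
      exact Matrix.mem_unitaryGroup_iff
    rw [h]
    exact isClosed_eq (by fun_prop) continuous_const
  · refine (Metric.isBounded_iff_subset_closedBall (0 : Mat p)).mpr ⟨1, fun A hA => ?_⟩
    rw [mem_closedBall_zero_iff]
    by_cases hn : Nontrivial (Mat p)
    · exact (CStarRing.norm_of_mem_unitary hA).le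
    · rw [not_nontrivial_iff_subsingleton] at hn
      rw [Subsingleton.elim A 0, norm_zero]
      exact zero_le_one

/-- Normalized Haar measure on the unitary group. -/
def haarUnitary (p : ℕ) : Measure (UGroup p) :=
  Measure.haarMeasure (⊤ : TopologicalSpace.PositiveCompacts (UGroup p))

/-- `Tr` of a matrix, as a real number (it is only applied to Hermitian matrices). -/
def trR {n : ℕ} (A : Mat n) : ℝ := (Matrix.trace A).re

/-- The absolute value `|A| = (A A*)^{1/2}`. -/
def mabs {n : ℕ} (A : Mat n) : Mat n := cfc Real.sqrt (A * Aᴴ)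

/-- The test function `ψ(t) = max(0, |t| - 1)`. -/
def psi (t : ℝ) : ℝ := max 0 (|t| - 1)

/-- The zero-padding embedding `ι : M_n(ℂ) → M_p(ℂ)`, used for `n ≤ p`. -/
def embed {n : ℕ} (p : ℕ) (A : Mat n) : Mat p :=
  Matrix.of fun i j =>
    if h : (i : ℕ) < n ∧ (j : ℕ) < n then A ⟨i, h.1⟩ ⟨j, h.2⟩ else 0

/-- A noncommutative multilinear polynomial in `m` variables with coefficients in `M_n(ℂ)`,
given by its coefficients `Q̂(S)`, `S ⊆ {1, …, m}`. -/
structure NCPoly (m n : ℕ) where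
  coeff : Finset (Fin m) → Mat n

namespace NCPoly

variable {m n : ℕ}

/-- `max {|S| : Q̂(S) ≠ 0}` (and `0` for the zero polynomial). -/
def degree (Q : NCPoly m n) : ℕ :=
  open Classical in (Finset.univ.filter fun S => Q.coeff S ≠ 0).sup Finset.card

/-- `Q(X_1, …, X_m) = ∑_S Q̂(S) ∏_{i ∈ S} X_i`, the products in increasing order of the index. -/
def eval (Q : NCPoly m n) (X : Fin m → Mat n) : Mat n :=
  ∑ S : Finset (Fin m), Q.coeff S * ((S.sort (· ≤ ·)).map X).prod

/-- The `i`-th influence `Inf_i Q = ∑_{S ∋ i} Tr(Q̂(S) Q̂(S)*)`. -/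
def influence (Q : NCPoly m n) (i : Fin m) : ℝ :=
  ∑ S : Finset (Fin m) with i ∈ S, trR (Q.coeff S * (Q.coeff S)ᴴ)

/-- The maximal influence `max_i Inf_i Q`. -/
def maxInfluence (Q : NCPoly m n) : ℝ := ⨆ i : Fin m, Q.influence i

/-- The polynomial `Q^ι` with coefficients `ι(Q̂(S)) ∈ M_p(ℂ)`. -/
def pad (p : ℕ) (Q : NCPoly m n) : NCPoly m p := ⟨fun S => embed p (Q.coeff S)⟩

/-- The value `Q(σ)` at a sign vector `σ ∈ {-1, 1}^m`: the `i`-th variable is `σ_i I`. -/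
def evalSign (Q : NCPoly m n) (σ : Fin m → ℤˣ) : Mat n :=
  Q.eval fun i => (((σ i : ℤˣ) : ℤ) : ℂ) • (1 : Mat n)

/-- `Q^ι(ι(G_1) H_1, …, ι(G_m) H_m)`. -/
def evalRot (p : ℕ) (Q : NCPoly m n) (ω : (Fin m → Mat n) × (Fin m → UGroup p)) : Mat p :=
  (Q.pad p).eval fun i => embed p (ω.1 i) * (ω.2 i : Mat p)

end NCPoly

/-- Expectation over a uniformly random sign vector in `{-1, 1}^m`. -/
def signExp {m : ℕ} (f : (Fin m → ℤˣ) → ℝ) : ℝ := ((2 : ℝ) ^ m)⁻¹ * ∑ σ, f σ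

/-- `μ` is the law of a random matrix `G ∈ M_n(ℂ)` with `E G = 0` and `E G G* = I`. -/
structure IsEnsemble {n : ℕ} (μ : Measure (Mat n)) : Prop where
  isProbabilityMeasure : IsProbabilityMeasure μ
  integrable : Integrable (fun A : Mat n => A) μ
  integrable_sq : Integrable (fun A : Mat n => A * Aᴴ) μ
  mean : ∫ A, A ∂μ = 0
  covariance : ∫ A, A * Aᴴ ∂μ = 1

/-- The joint law of `(G_1, …, G_m, H_1, …, H_m)`, all independent, with every `G_i` of law `μ`
and every `H_i` a Haar-distributed `p × p` unitary. -/
def inputLaw (m p : ℕ) {n : ℕ} (μ : Measure (Mat n)) :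
    Measure ((Fin m → Mat n) × (Fin m → UGroup p)) :=
  (Measure.pi fun _ => μ).prod (Measure.pi fun _ => haarUnitary p)

end NCMaj

end

/-!
Multiplying on the left by `ι(1)` fixes `𝐐`, so `𝐐 𝐐*` is the zero-padding of an `n × n` matrix
(`rotGram`), a double sum over pairs `S, T` of coefficients. The proof compares this matrix with

* `lowRotGram`, the sum `Q̂(∅) Q̂(∅)* + ∑ᵢ Q̂({i}) Gᵢ Gᵢ* Q̂({i})*` of its diagonal terms of degree
  at most one, and
* `lowGram`, the mean `∑_{|S| ≤ 1} Q̂(S) Q̂(S)*` of the latter.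

Every other term of `rotGram` contains the upper left `n × n` corner of some `Hᵢ` or of some
`Hᵢ Hⱼ*` with `i ≠ j`: two consecutive factors `ι(Gᵢ) Hᵢ ι(Gⱼ) Hⱼ` only see the corner of `Hᵢ`, and
the terms of degree at most one meet in the products `Hᵢ Hⱼ*`, `Hᵢ` and `Hⱼ*`
(`opNorm_rotTerm_mul_le`). Invariance of Haar measure gives every entry of such a matrix the second
moment `1 / p` (`integral_norm_sq_entry`), so the corners are of size `p ^ (-1/2)` on average. This
gives the error term `C(m, n) τ ^ (-1/3) p ^ (-1/2)`, with a constant that does not depend on the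
ensemble because only second moments of the `Gᵢ` enter.

The difference `lowRotGram - lowGram = ∑ᵢ Q̂({i}) (Gᵢ Gᵢ* - 1) Q̂({i})*` is a sum of independent
centered matrices. Its mean square Frobenius norm is at most
`c₂ ∑ᵢ (Tr Q̂({i}) Q̂({i})*)² ≤ c₂ τ n` (`integral_frobSq_sum_sub_le`), which gives the other error
term, since `τ ≤ n`, and `d ≥ 1` unless `τ = 0`.

Both differences pass through `ψ` by the variational formula
`Tr (X - 1)₊ = max_{0 ≤ P ≤ 1} Tr ((X - 1) P)` for `X ≥ 0` (`trR_sub_one_mul_le`,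
`exists_effect_trR_psi_eq`). The same formula gives Jensen's inequality
`Tr ψ(lowGram) ≤ E_b Tr ψ(|Q(b)|²)` (`trR_psi_lowGram_le`), since
`E_b Q(b) Q(b)* = ∑_S Q̂(S) Q̂(S)* ≥ lowGram`. For contractions on the cube the right-hand side
vanishes, and `(max(0, s - 1))² ≤ ψ(s²)` reduces the second quantity to the first.
-/

noncomputable section

open scoped ComplexOrder

namespace NCMaj

variable {k l m n p : ℕ}

/-! ### Frobenius norm and real trace -/

/-- The square of the Frobenius norm of a matrix. -/
def frobSq {k l : ℕ} (A : Matrix (Fin k) (Fin l) ℂ) : ℝ := ∑ i, ∑ j, ‖A i j‖ ^ 2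

lemma frobSq_nonneg (A : Matrix (Fin k) (Fin l) ℂ) : 0 ≤ frobSq A := by
  unfold frobSq; positivity

lemma trR_add (A B : Mat n) : trR (A + B) = trR A + trR B := by simp [trR]

lemma trR_sub (A B : Mat n) : trR (A - B) = trR A - trR B := by simp [trR]

lemma trR_sum {ι : Type*} (s : Finset ι) (A : ι → Mat n) :
    trR (∑ i ∈ s, A i) = ∑ i ∈ s, trR (A i) := by
  simp [trR, Matrix.trace_sum]

lemma trR_smul (c : ℝ) (A : Mat n) : trR (c • A) = c * trR A := by
  simp [trR]

lemma trR_mul_conjTranspose (A : Matrix (Fin k) (Fin l) ℂ) : trR (A * Aᴴ) = frobSq A := by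
  simp only [trR, Matrix.trace, Matrix.diag, Matrix.mul_apply, Matrix.conjTranspose_apply,
    Complex.re_sum, frobSq]
  refine Finset.sum_congr rfl fun i _ => Finset.sum_congr rfl fun j _ => ?_
  rw [← Complex.normSq_eq_norm_sq]
  simp [Complex.normSq_apply]

lemma frobSq_conjTranspose (A : Matrix (Fin k) (Fin l) ℂ) : frobSq Aᴴ = frobSq A := by
  unfold frobSq
  rw [Finset.sum_comm]
  simp

/-- The mixed submultiplicativity of the Frobenius and the operator norm. -/
lemma frobSq_mul_le (A : Matrix (Fin k) (Fin l) ℂ) (Z : Mat l) :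
    frobSq (A * Z) ≤ frobSq A * ‖Z‖ ^ 2 := by
  have hrow (i : Fin k) : ∑ j, ‖(A * Z) i j‖ ^ 2 ≤ (∑ j, ‖A i j‖ ^ 2) * ‖Z‖ ^ 2 := by
    have h := Matrix.l2_opNorm_mulVec Zᴴ (WithLp.toLp 2 fun j => star (A i j))
    rw [Matrix.l2_opNorm_conjTranspose] at h
    have h2 := pow_le_pow_left₀ (norm_nonneg _) h 2
    rw [mul_pow, EuclideanSpace.norm_sq_eq, EuclideanSpace.norm_sq_eq, mul_comm] at h2
    have h3 (j : Fin l) : ‖(A * Z) i j‖ = ‖(Zᴴ *ᵥ fun j => star (A i j)) j‖ := by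
      simp only [Matrix.mulVec, dotProduct, Matrix.conjTranspose_apply, Matrix.mul_apply]
      rw [← norm_star (∑ x, A i x * Z x j), star_sum]
      congr 1
      exact Finset.sum_congr rfl fun x _ => by rw [star_mul]
    have h4 (j : Fin l) : ‖A i j‖ = ‖star (A i j)‖ := (norm_star _).symm
    simp only [h3]
    simp only [h4]
    exact h2
  unfold frobSq
  rw [Finset.sum_mul]
  exact Finset.sum_le_sum fun i _ => hrow i

lemma frobSq_one : frobSq (1 : Mat n) = n := by
  rw [← trR_mul_conjTranspose]
  simp [trR]

lemma frobSq_le_opNorm (Z : Mat n) : frobSq Z ≤ n * ‖Z‖ ^ 2 := by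
  simpa [frobSq_one] using frobSq_mul_le (1 : Mat n) Z

lemma opNorm_sq_le_frobSq (A : Matrix (Fin k) (Fin l) ℂ) : ‖A‖ ^ 2 ≤ frobSq A := by
  have h : ‖A‖ ≤ √(frobSq A) := by
    rw [Matrix.l2_opNorm_def]
    refine ContinuousLinearMap.opNorm_le_bound _ (Real.sqrt_nonneg _) fun x => ?_
    rw [EuclideanSpace.norm_eq, EuclideanSpace.norm_eq, ← Real.sqrt_mul (frobSq_nonneg _)]
    refine Real.sqrt_le_sqrt ?_
    rw [frobSq, Finset.sum_mul]
    refine Finset.sum_le_sum fun i _ => ?_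
    have h1 : ‖∑ j, A i j * x j‖ ≤ ∑ j, ‖A i j‖ * ‖x j‖ :=
      (norm_sum_le _ _).trans (by simp)
    refine le_trans ?_ (Finset.sum_mul_sq_le_sq_mul_sq Finset.univ _ _)
    refine pow_le_pow_left₀ (norm_nonneg _) ?_ 2
    simpa [Matrix.toLpLin_apply, Matrix.mulVec, dotProduct] using h1
  calc ‖A‖ ^ 2 ≤ √(frobSq A) ^ 2 := pow_le_pow_left₀ (norm_nonneg _) h 2
    _ = frobSq A := Real.sq_sqrt (frobSq_nonneg _)

/-- Cauchy–Schwarz for the trace pairing. -/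
lemma trR_mul_le (Z P : Mat n) : trR (Z * P) ≤ √(frobSq Z) * √(frobSq P) := by
  have h1 : trR (Z * P) ≤ ∑ x : Fin n × Fin n, ‖Z x.1 x.2‖ * ‖P x.2 x.1‖ := by
    rw [Fintype.sum_prod_type]
    simp only [trR, Matrix.trace, Matrix.diag, Matrix.mul_apply, Complex.re_sum]
    refine Finset.sum_le_sum fun i _ => Finset.sum_le_sum fun j _ => ?_
    rw [← norm_mul]
    exact Complex.re_le_norm _
  refine h1.trans ?_
  rw [← Real.sqrt_mul (frobSq_nonneg _)]
  refine Real.le_sqrt_of_sq_le ?_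
  refine (Finset.sum_mul_sq_le_sq_mul_sq _ _ _).trans_eq ?_
  congr 1
  · rw [Fintype.sum_prod_type]; rfl
  · rw [Fintype.sum_prod_type, ← frobSq_conjTranspose]; simp [frobSq]

/-! ### A variational formula for the trace of `ψ` -/

lemma trR_mul_nonneg {A P : Mat n} (hA : A.PosSemidef) (hP : P.PosSemidef) :
    0 ≤ trR (A * P) := by
  open scoped MatrixOrder in
  obtain ⟨B, rfl⟩ := CStarAlgebra.nonneg_iff_eq_star_mul_self.mp
    (Matrix.nonneg_iff_posSemidef.mpr hP)
  have h := (hA.mul_mul_conjTranspose_same B).trace_nonneg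
  rw [Matrix.trace_mul_comm, ← Matrix.mul_assoc, ← Matrix.trace_mul_comm] at h
  exact (Complex.le_def.mp h).1

lemma trR_nonneg {A : Mat n} (hA : A.PosSemidef) : 0 ≤ trR A :=
  (Complex.le_def.mp hA.trace_nonneg).1

/-- The effects `0 ≤ P ≤ 1`, over which the trace of a positive part is a supremum. -/
structure IsEffect (P : Mat n) : Prop where
  posSemidef : P.PosSemidef
  one_sub : (1 - P).PosSemidef

lemma IsEffect.frobSq_le {P : Mat n} (hP : IsEffect P) : frobSq P ≤ n := by
  have h1 := trR_mul_nonneg hP.posSemidef hP.one_sub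
  have h2 := trR_nonneg hP.one_sub
  rw [mul_sub, mul_one, trR_sub] at h1
  rw [trR_sub] at h2
  rw [← trR_mul_conjTranspose, hP.posSemidef.isHermitian.eq]
  have : trR (1 : Mat n) = n := by simp [trR]
  linarith

lemma trR_mul_effect_le (Z : Mat n) {P : Mat n} (hP : IsEffect P) :
    trR (Z * P) ≤ √n * √(frobSq Z) := by
  rw [mul_comm]
  refine (trR_mul_le Z P).trans ?_
  gcongr
  exact hP.frobSq_le

lemma trR_mul_effect_le_opNorm (Z : Mat n) {P : Mat n} (hP : IsEffect P) :
    trR (Z * P) ≤ n * ‖Z‖ := by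
  refine (trR_mul_effect_le Z hP).trans ?_
  rw [← Real.sqrt_mul (Nat.cast_nonneg n)]
  refine Real.sqrt_le_iff.mpr ⟨by positivity, ?_⟩
  have := mul_le_mul_of_nonneg_left (frobSq_le_opNorm Z) (Nat.cast_nonneg (α := ℝ) n)
  nlinarith

/-- Every function is continuous on the spectrum of a matrix, which is finite, so the functional
calculus also applies to indicator functions. -/
lemma continuousOn_spectrum (f : ℝ → ℝ) (X : Mat n) : ContinuousOn f (spectrum ℝ X) :=
  (Matrix.finite_real_spectrum (A := X)).continuousOn f

lemma spectrum_nonneg {X : Mat n} (hX : X.PosSemidef) {x : ℝ} (hx : x ∈ spectrum ℝ X) :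
    0 ≤ x := by
  open scoped MatrixOrder in
  exact spectrum_nonneg_of_nonneg (Matrix.nonneg_iff_posSemidef.mpr hX) hx

lemma posSemidef_cfc {f : ℝ → ℝ} {X : Mat n} (hf : ∀ x ∈ spectrum ℝ X, 0 ≤ f x) :
    (cfc f X).PosSemidef := by
  open scoped MatrixOrder in
  exact Matrix.nonneg_iff_posSemidef.mp (cfc_nonneg hf)

lemma trR_cfc_mono {f g : ℝ → ℝ} {X : Mat n} (hf : ∀ x ∈ spectrum ℝ X, f x ≤ g x) :
    trR (cfc f X) ≤ trR (cfc g X) := by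
  have h : (cfc (fun x => g x - f x) X).PosSemidef :=
    posSemidef_cfc fun x hx => sub_nonneg.mpr (hf x hx)
  rw [cfc_sub g f X (continuousOn_spectrum _ X) (continuousOn_spectrum _ X)] at h
  have := trR_nonneg h
  rw [trR_sub] at this
  linarith

lemma cfc_sub_one {X : Mat n} (hX : X.PosSemidef) :
    cfc (fun t : ℝ => t - 1) X = X - 1 := by
  have hs : IsSelfAdjoint X := hX.isHermitian
  rw [cfc_sub (fun t : ℝ => t) (fun _ => 1) X, cfc_id' ℝ X, cfc_const_one ℝ X]

lemma psi_of_nonneg {t : ℝ} (ht : 0 ≤ t) : psi t = max 0 (t - 1) := by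
  rw [psi, abs_of_nonneg ht]

/-- Every effect gives a lower bound for the trace of `ψ` of a positive semidefinite matrix. -/
lemma trR_sub_one_mul_le {X P : Mat n} (hX : X.PosSemidef) (hP : IsEffect P) :
    trR ((X - 1) * P) ≤ trR (cfc psi X) := by
  have h1 : (cfc psi X).PosSemidef := posSemidef_cfc fun x _ => le_max_left _ _
  have h2 : (cfc psi X - (X - 1)).PosSemidef := by
    rw [← cfc_sub_one hX, ← cfc_sub psi _ X (continuousOn_spectrum _ X)]
    refine posSemidef_cfc fun x hx => ?_
    rw [psi_of_nonneg (spectrum_nonneg hX hx)]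
    simp
  have h3 := trR_mul_nonneg h1 hP.one_sub
  have h4 := trR_mul_nonneg h2 hP.posSemidef
  rw [mul_sub, mul_one, trR_sub] at h3
  rw [sub_mul, trR_sub] at h4
  linarith

/-- The lower bound of `trR_sub_one_mul_le` is attained, at the spectral projection of `(1, ∞)`. -/
lemma exists_effect_trR_psi_eq {Y : Mat n} (hY : Y.PosSemidef) :
    ∃ P : Mat n, IsEffect P ∧ trR (cfc psi Y) = trR ((Y - 1) * P) := by
  classical
  have hs : IsSelfAdjoint Y := hY.isHermitian
  let f : ℝ → ℝ := fun t => if 1 < t then 1 else 0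
  refine ⟨cfc f Y, ⟨posSemidef_cfc fun x _ => ?_, ?_⟩, ?_⟩
  · simp only [f]; split_ifs <;> norm_num
  · rw [← cfc_const_one ℝ Y, ← cfc_sub _ f Y (by fun_prop) (continuousOn_spectrum _ Y)]
    refine posSemidef_cfc fun x _ => ?_
    simp only [f]; split_ifs <;> norm_num
  · rw [← cfc_sub_one hY, ← cfc_mul _ f Y (by fun_prop) (continuousOn_spectrum _ Y)]
    congr 1
    refine cfc_congr fun x hx => ?_
    simp only [f]
    rw [psi_of_nonneg (spectrum_nonneg hY hx)]
    split_ifs with h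
    · rw [mul_one, max_eq_right (by linarith)]
    · rw [mul_zero, max_eq_left (by linarith)]

lemma trR_psi_nonneg (X : Mat n) : 0 ≤ trR (cfc psi X) :=
  trR_nonneg (posSemidef_cfc fun _ _ => le_max_left _ _)

lemma trR_psi_le_trR {X : Mat n} (hX : X.PosSemidef) : trR (cfc psi X) ≤ trR X := by
  have hs : IsSelfAdjoint X := hX.isHermitian
  conv_rhs => rw [← cfc_id' ℝ X]
  refine trR_cfc_mono fun x hx => ?_
  have := spectrum_nonneg hX hx
  rw [psi_of_nonneg this]
  exact max_le this (by linarith)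

/-- Not an equality, as the norm is `0` when `n = 0`. -/
lemma opNorm_one_le : ‖(1 : Mat n)‖ ≤ 1 := by
  have := Matrix.l2_opNorm_diagonal (𝕜 := ℂ) (fun _ : Fin n => 1)
  rw [Matrix.diagonal_one] at this
  rw [this]
  exact (pi_norm_le_iff_of_nonneg zero_le_one).mpr (by simp)

lemma trR_psi_eq_zero {X : Mat n} (hX : X.PosSemidef) (h : ‖X‖ ≤ 1) : trR (cfc psi X) = 0 := by
  have : cfc psi X = cfc (fun _ : ℝ => (0 : ℝ)) X := by
    refine cfc_congr fun x hx => ?_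
    have h0 := spectrum_nonneg hX hx
    have h1 : ‖x‖ ≤ ‖X‖ * ‖(1 : Mat n)‖ := spectrum.norm_le_norm_mul_of_mem hx
    have h2 := opNorm_one_le (n := n)
    rw [Real.norm_of_nonneg h0] at h1
    rw [psi_of_nonneg h0, max_eq_left]
    have : ‖X‖ * ‖(1 : Mat n)‖ ≤ 1 * 1 := by gcongr
    linarith
  rw [this, cfc_const_zero]
  simp [trR]

/-! ### Functions of the absolute value -/

lemma mabs_sq {k : ℕ} (A : Mat k) : mabs A ^ 2 = A * Aᴴ := by
  have hX : (A * Aᴴ).PosSemidef := Matrix.posSemidef_self_mul_conjTranspose A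
  have hs : IsSelfAdjoint (A * Aᴴ) := hX.isHermitian
  rw [mabs, ← cfc_pow _ 2 _ (continuousOn_spectrum _ _)]
  conv_rhs => rw [← cfc_id' ℝ (A * Aᴴ)]
  exact cfc_congr fun x hx => Real.sq_sqrt (spectrum_nonneg hX hx)

lemma cfc_mabs_sq {k : ℕ} (A : Mat k) :
    (cfc (fun t : ℝ => max 0 (t - 1)) (mabs A)) ^ 2
      = cfc (fun t : ℝ => max 0 (√t - 1) ^ 2) (A * Aᴴ) := by
  have hX : (A * Aᴴ).PosSemidef := Matrix.posSemidef_self_mul_conjTranspose A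
  have hs : IsSelfAdjoint (A * Aᴴ) := hX.isHermitian
  rw [mabs, ← cfc_comp (fun t : ℝ => max 0 (t - 1)) Real.sqrt (A * Aᴴ),
    ← cfc_pow _ 2 _ (continuousOn_spectrum _ _)]
  rfl

/-- The inequality `(max(0, s - 1))² ≤ ψ(s²)` for `s ≥ 0`, applied to `|A|`. -/
lemma trR_cfc_mabs_sq_le {k : ℕ} (A : Mat k) :
    trR ((cfc (fun t : ℝ => max 0 (t - 1)) (mabs A)) ^ 2) ≤ trR (cfc psi (A * Aᴴ)) := by
  have hX : (A * Aᴴ).PosSemidef := Matrix.posSemidef_self_mul_conjTranspose A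
  rw [cfc_mabs_sq]
  refine trR_cfc_mono fun x hx => ?_
  have h0 := spectrum_nonneg hX hx
  rw [psi_of_nonneg h0]
  rcases le_total (√x) 1 with h | h
  · rw [max_eq_left (by linarith : √x - 1 ≤ 0)]; simp
  · rw [max_eq_right (by linarith : 0 ≤ √x - 1)]
    have := Real.sq_sqrt h0
    exact le_max_of_le_right (by nlinarith)

lemma continuous_trR : Continuous (trR : Mat n → ℝ) := by
  unfold trR
  exact Complex.continuous_re.comp (continuous_id.matrix_trace)

/-- Continuous functions act continuously, through `A ↦ tr f(A A*)`. -/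
lemma continuous_trR_cfc {k : ℕ} {f : ℝ → ℝ} (hf : Continuous f) :
    Continuous fun A : Mat k => trR (cfc f (A * Aᴴ)) := by
  refine continuous_trR.comp ?_
  refine Continuous.cfc_of_mem_nhdsSet (s := Set.univ) f (fun A => ?_) ?_ (fun A => ?_)
    hf.continuousOn
  · simp
  · fun_prop
  · exact (Matrix.isHermitian_mul_conjTranspose_self A)

/-! ### Zero-padding as conjugation by an isometry -/

/-- The coordinate inclusion `ℂⁿ → ℂᵖ`, an isometry when `n ≤ p`. -/
def incl (n p : ℕ) : Matrix (Fin p) (Fin n) ℂ :=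
  Matrix.of fun i j => if (i : ℕ) = j then 1 else 0

lemma incl_conjTranspose_mul_incl (h : n ≤ p) : (incl n p)ᴴ * incl n p = 1 := by
  ext a b
  simp only [Matrix.mul_apply, Matrix.conjTranspose_apply, incl, Matrix.of_apply]
  rw [Finset.sum_eq_single (Fin.castLE h a)]
  · by_cases hab : a = b
    · subst hab; simp
    · have : (a : ℕ) ≠ b := fun h' => hab (Fin.ext h')
      simp [this, Matrix.one_apply_ne hab]
  · intro i _ hi
    have : (i : ℕ) ≠ a := fun h' => hi (Fin.ext h')
    simp [this]
  · simp

lemma embed_eq (A : Mat n) : embed p A = incl n p * A * (incl n p)ᴴ := by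
  ext i j
  simp only [embed, Matrix.of_apply, Matrix.mul_apply, Matrix.conjTranspose_apply, incl]
  by_cases hj : (j : ℕ) < n
  · rw [Finset.sum_eq_single (⟨j, hj⟩ : Fin n)]
    · by_cases hi : (i : ℕ) < n
      · rw [Finset.sum_eq_single (⟨i, hi⟩ : Fin n)]
        · simp [hi, hj]
        · intro a _ ha
          have : (i : ℕ) ≠ a := fun h' => ha (Fin.ext h'.symm)
          simp [this]
        · simp
      · have (a : Fin n) : (i : ℕ) ≠ a := by omega
        simp [hi, this]
    · intro b _ hb
      have : (j : ℕ) ≠ b := fun h' => hb (Fin.ext h'.symm)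
      simp [this]
    · simp
  · have (a : Fin n) : (j : ℕ) ≠ a := by omega
    simp [hj, this]

lemma corner_apply (h : n ≤ p) (A : Mat p) (a b : Fin n) :
    ((incl n p)ᴴ * A * incl n p) a b = A (Fin.castLE h a) (Fin.castLE h b) := by
  simp only [Matrix.mul_apply, Matrix.conjTranspose_apply, incl, Matrix.of_apply]
  rw [Finset.sum_eq_single (Fin.castLE h b), Finset.sum_eq_single (Fin.castLE h a)]
  · simp
  · intro i _ hi
    have : (i : ℕ) ≠ a := fun h' => hi (Fin.ext h')
    simp [this]
  · simp
  · intro i _ hi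
    have : (i : ℕ) ≠ b := fun h' => hi (Fin.ext h')
    simp [this]
  · simp

lemma opNorm_mul_le_mul {q : ℕ} {A : Matrix (Fin k) (Fin l) ℂ} {B : Matrix (Fin l) (Fin q) ℂ}
    {a b : ℝ} (ha : ‖A‖ ≤ a) (hb : ‖B‖ ≤ b) : ‖A * B‖ ≤ a * b :=
  (Matrix.l2_opNorm_mul A B).trans
    (mul_le_mul ha hb (norm_nonneg _) ((norm_nonneg _).trans ha))

lemma opNorm_le_one_of_conjTranspose_mul_self {A : Matrix (Fin k) (Fin l) ℂ} (h : Aᴴ * A = 1) :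
    ‖A‖ ≤ 1 := by
  have h1 := Matrix.l2_opNorm_conjTranspose_mul_self A
  rw [h] at h1
  have h2 := opNorm_one_le (n := l)
  nlinarith [norm_nonneg A]

lemma opNorm_incl_le (h : n ≤ p) : ‖incl n p‖ ≤ 1 :=
  opNorm_le_one_of_conjTranspose_mul_self (incl_conjTranspose_mul_incl h)

lemma opNorm_incl_conjTranspose_le (h : n ≤ p) : ‖(incl n p)ᴴ‖ ≤ 1 := by
  rw [Matrix.l2_opNorm_conjTranspose]; exact opNorm_incl_le h

lemma conjTranspose_mul_self_unitary (H : UGroup p) : (H : Mat p)ᴴ * (H : Mat p) = 1 :=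
  Matrix.mem_unitaryGroup_iff'.mp H.2

lemma self_mul_conjTranspose_unitary (H : UGroup p) : (H : Mat p) * (H : Mat p)ᴴ = 1 :=
  Matrix.mem_unitaryGroup_iff.mp H.2

lemma opNorm_unitary_le (H : UGroup p) : ‖(H : Mat p)‖ ≤ 1 :=
  opNorm_le_one_of_conjTranspose_mul_self (conjTranspose_mul_self_unitary H)

lemma IsEffect.compress (h : n ≤ p) {P : Mat p} (hP : IsEffect P) :
    IsEffect ((incl n p)ᴴ * P * incl n p) where
  posSemidef := hP.posSemidef.conjTranspose_mul_mul_same _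
  one_sub := by
    have := hP.one_sub.conjTranspose_mul_mul_same (incl n p)
    rwa [Matrix.mul_sub, Matrix.sub_mul, Matrix.mul_one, incl_conjTranspose_mul_incl h] at this

lemma posSemidef_one_sub_incl (h : n ≤ p) :
    (1 - incl n p * (incl n p)ᴴ).PosSemidef := by
  have h2 : (1 - incl n p * (incl n p)ᴴ)ᴴ * (1 - incl n p * (incl n p)ᴴ)
      = 1 - incl n p * (incl n p)ᴴ := by
    simp only [Matrix.conjTranspose_sub, Matrix.conjTranspose_one, Matrix.conjTranspose_mul,
      Matrix.conjTranspose_conjTranspose, mul_sub, sub_mul, mul_one, one_mul]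
    rw [Matrix.mul_assoc, ← Matrix.mul_assoc _ (incl n p), incl_conjTranspose_mul_incl h,
      Matrix.one_mul]
    abel
  rw [← h2]
  exact Matrix.posSemidef_conjTranspose_mul_self _

/-- Comparison of the traces of `ψ` of the padding of `B` and of `X`, up to the pairing of `B - X`
with an effect. -/
lemma exists_effect_trR_psi_pad_le (h : n ≤ p) {B X : Mat n} (hB : B.PosSemidef)
    (hX : X.PosSemidef) :
    ∃ P : Mat n, IsEffect P ∧
      trR (cfc psi (incl n p * B * (incl n p)ᴴ)) ≤ trR (cfc psi X) + trR ((B - X) * P) := by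
  obtain ⟨P, hP, hPeq⟩ := exists_effect_trR_psi_eq (hB.mul_mul_conjTranspose_same (incl n p))
  refine ⟨_, hP.compress h, ?_⟩
  rw [hPeq]
  have h1 := trR_sub_one_mul_le hX (hP.compress h)
  have h2 : trR (incl n p * B * (incl n p)ᴴ * P) = trR (B * ((incl n p)ᴴ * P * incl n p)) := by
    simp only [trR]
    rw [Matrix.mul_assoc, Matrix.mul_assoc, Matrix.trace_mul_comm, Matrix.mul_assoc]
  have h3 : trR ((incl n p)ᴴ * P * incl n p) = trR ((incl n p * (incl n p)ᴴ) * P) := by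
    simp only [trR]
    rw [Matrix.trace_mul_comm, Matrix.mul_assoc]
  -- Compression by the isometry does not increase the trace of `P`, so the `p - n` zero eigenvalues
  -- of the padding do not count.
  have h4 := trR_mul_nonneg (posSemidef_one_sub_incl h) hP.posSemidef
  rw [sub_mul, one_mul, trR_sub] at h4 h1 ⊢
  rw [sub_mul, trR_sub]
  linarith

namespace NCPoly

/-! ### Expansion of the rotated polynomial -/

/-- The product of the `ι(G_i) H_i` along a list of indices, in the order of the list. -/
def rotProd (p : ℕ) (ω : (Fin m → Mat n) × (Fin m → UGroup p)) (L : List (Fin m)) : Mat p :=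
  (L.map fun i => embed p (ω.1 i) * (ω.2 i : Mat p)).prod

/-- The contribution of `S` to `Q^ι(ι(G_1) H_1, …, ι(G_m) H_m)`, as an `n × p` matrix:
only its first `n` rows can be nonzero. -/
def rotTerm (p : ℕ) (Q : NCPoly m n) (ω : (Fin m → Mat n) × (Fin m → UGroup p))
    (S : Finset (Fin m)) : Matrix (Fin n) (Fin p) ℂ :=
  Q.coeff S * ((incl n p)ᴴ * rotProd p ω (S.sort (· ≤ ·)))

lemma evalRot_eq (Q : NCPoly m n) (ω : (Fin m → Mat n) × (Fin m → UGroup p)) :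
    Q.evalRot p ω = incl n p * ∑ S, Q.rotTerm p ω S := by
  simp only [evalRot, eval, pad, embed_eq, Matrix.mul_sum, rotTerm, rotProd, Matrix.mul_assoc]

/-- The `n × n` block carrying `𝐐 𝐐*`. -/
def rotGram (p : ℕ) (Q : NCPoly m n) (ω : (Fin m → Mat n) × (Fin m → UGroup p)) : Mat n :=
  (∑ S, Q.rotTerm p ω S) * (∑ S, Q.rotTerm p ω S)ᴴ

lemma evalRot_mul_conjTranspose (Q : NCPoly m n) (ω : (Fin m → Mat n) × (Fin m → UGroup p)) :
    Q.evalRot p ω * (Q.evalRot p ω)ᴴ = incl n p * Q.rotGram p ω * (incl n p)ᴴ := by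
  rw [evalRot_eq, rotGram, Matrix.conjTranspose_mul]
  simp only [Matrix.mul_assoc]

lemma posSemidef_rotGram (Q : NCPoly m n) (ω : (Fin m → Mat n) × (Fin m → UGroup p)) :
    (Q.rotGram p ω).PosSemidef := Matrix.posSemidef_self_mul_conjTranspose _

lemma opNorm_rotFactor_le (h : n ≤ p) (G : Mat n) (H : UGroup p) :
    ‖embed p G * (H : Mat p)‖ ≤ ‖G‖ := by
  rw [embed_eq]
  calc ‖incl n p * G * (incl n p)ᴴ * (H : Mat p)‖
      ≤ ‖incl n p‖ * ‖G‖ * ‖(incl n p)ᴴ‖ * ‖(H : Mat p)‖ := by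
        refine (Matrix.l2_opNorm_mul _ _).trans ?_
        gcongr
        refine (Matrix.l2_opNorm_mul _ _).trans ?_
        gcongr
        exact Matrix.l2_opNorm_mul _ _
    _ ≤ 1 * ‖G‖ * 1 * 1 := by
        gcongr
        exacts [opNorm_incl_le h, opNorm_incl_conjTranspose_le h, opNorm_unitary_le H]
    _ = ‖G‖ := by ring

/-- The product of `1 + ‖G_i‖` over a list of indices. -/
def gain (G : Fin m → Mat n) (L : List (Fin m)) : ℝ := (L.map fun i => 1 + ‖G i‖).prod

lemma opNorm_rotProd_le (h : n ≤ p) (ω : (Fin m → Mat n) × (Fin m → UGroup p))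
    (L : List (Fin m)) : ‖rotProd p ω L‖ ≤ gain ω.1 L := by
  induction L with
  | nil => simpa [rotProd, gain] using opNorm_one_le
  | cons i L ih =>
    simp only [rotProd, gain, List.map_cons, List.prod_cons] at ih ⊢
    refine (Matrix.l2_opNorm_mul _ _).trans ?_
    gcongr
    exact (opNorm_rotFactor_le h _ _).trans (by simp)

/-- The product of `1 + ‖G_i‖` over all indices, which bounds the norm of every product of distinct
factors `ι(G_i) H_i`. -/
def totalGain (G : Fin m → Mat n) : ℝ := ∏ i, (1 + ‖G i‖)

lemma one_le_totalGain (G : Fin m → Mat n) : 1 ≤ totalGain G :=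
  Finset.one_le_prod fun i _ => by simp

lemma gain_sort_le (G : Fin m → Mat n) (S : Finset (Fin m)) :
    gain G (S.sort (· ≤ ·)) ≤ totalGain G := by
  have : gain G (S.sort (· ≤ ·)) = ∏ i ∈ S, (1 + ‖G i‖) := by
    rw [gain, Finset.prod, ← Multiset.prod_coe, ← Multiset.map_coe, Finset.sort_eq]
  rw [this, totalGain]
  exact Finset.prod_le_prod_of_subset_of_one_le (Finset.subset_univ S) (fun i _ => by positivity)
    (fun i _ _ => by simp)

/-- The operator norm of the upper left `n × n` corner of a `p × p` matrix. -/
def cornerNorm (n : ℕ) {p : ℕ} (A : Mat p) : ℝ := ‖(incl n p)ᴴ * A * incl n p‖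

lemma cornerNorm_nonneg (A : Mat p) : 0 ≤ cornerNorm n A := norm_nonneg _

lemma cornerNorm_conjTranspose (A : Mat p) : cornerNorm n Aᴴ = cornerNorm n A := by
  rw [cornerNorm, ← Matrix.l2_opNorm_conjTranspose]
  simp [cornerNorm, Matrix.conjTranspose_mul, Matrix.mul_assoc]

/-- The total size of the `n × n` corners of the `H_i` and of the `H_i H_j*` with `i ≠ j`. -/
def cornerSize (n p : ℕ) (H : Fin m → UGroup p) : ℝ :=
  ∑ i, cornerNorm n (H i : Mat p) +
    ∑ i, ∑ j with j ≠ i, cornerNorm n ((H i : Mat p) * (H j : Mat p)ᴴ)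

lemma cornerSize_nonneg (H : Fin m → UGroup p) : 0 ≤ cornerSize n p H :=
  add_nonneg (Finset.sum_nonneg fun _ _ => cornerNorm_nonneg _)
    (Finset.sum_nonneg fun _ _ => Finset.sum_nonneg fun _ _ => cornerNorm_nonneg _)

lemma corner_le_cornerSize (H : Fin m → UGroup p) (i : Fin m) :
    cornerNorm n (H i : Mat p) ≤ cornerSize n p H := by
  unfold cornerSize
  have h1 := Finset.single_le_sum (s := Finset.univ)
    (f := fun i => cornerNorm n (H i : Mat p))
    (fun _ _ => cornerNorm_nonneg _) (Finset.mem_univ i)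
  exact h1.trans (le_add_of_nonneg_right
    (Finset.sum_nonneg fun _ _ => Finset.sum_nonneg fun _ _ => cornerNorm_nonneg _))

lemma corner_mul_le_cornerSize (H : Fin m → UGroup p) {i j : Fin m} (hij : j ≠ i) :
    cornerNorm n ((H i : Mat p) * (H j : Mat p)ᴴ) ≤ cornerSize n p H := by
  unfold cornerSize
  have h1 := Finset.single_le_sum (s := Finset.univ.filter fun j => j ≠ i)
    (f := fun j => cornerNorm n ((H i : Mat p) * (H j : Mat p)ᴴ))
    (fun _ _ => cornerNorm_nonneg _) (Finset.mem_filter.mpr ⟨Finset.mem_univ j, hij⟩)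
  have h2 := Finset.single_le_sum (s := Finset.univ)
    (f := fun i => ∑ j with j ≠ i, cornerNorm n ((H i : Mat p) * (H j : Mat p)ᴴ))
    (fun _ _ => Finset.sum_nonneg fun _ _ => cornerNorm_nonneg _) (Finset.mem_univ i)
  exact (h1.trans h2).trans (le_add_of_nonneg_left
    (Finset.sum_nonneg fun _ _ => cornerNorm_nonneg _))

lemma opNorm_rotTerm_le (h : n ≤ p) (Q : NCPoly m n) (ω : (Fin m → Mat n) × (Fin m → UGroup p))
    (S : Finset (Fin m)) : ‖Q.rotTerm p ω S‖ ≤ ‖Q.coeff S‖ * totalGain ω.1 := by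
  unfold rotTerm
  refine (Matrix.l2_opNorm_mul _ _).trans ?_
  gcongr
  refine (Matrix.l2_opNorm_mul _ _).trans ?_
  calc _ ≤ 1 * totalGain ω.1 := by
        gcongr
        exacts [opNorm_incl_conjTranspose_le h, (opNorm_rotProd_le h ω _).trans (gain_sort_le _ _)]
    _ = _ := one_mul _

/-- Between two consecutive factors `ι(G_i) H_i` and `ι(G_j) H_j` only the corner of `H_i`
survives, so terms of degree at least two are small. -/
lemma opNorm_rotTerm_le_of_two_le (h : n ≤ p) (Q : NCPoly m n)
    (ω : (Fin m → Mat n) × (Fin m → UGroup p)) {S : Finset (Fin m)} (hS : 2 ≤ S.card) :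
    ‖Q.rotTerm p ω S‖ ≤ ‖Q.coeff S‖ * (totalGain ω.1 * cornerSize n p ω.2) := by
  unfold rotTerm
  refine (Matrix.l2_opNorm_mul _ _).trans ?_
  gcongr
  have hlen : 2 ≤ (S.sort (· ≤ ·)).length := by rwa [Finset.length_sort]
  have hg := gain_sort_le ω.1 S
  rcases hL : S.sort (· ≤ ·) with _ | ⟨i, _ | ⟨j, L⟩⟩
  · simp [hL] at hlen
  · simp [hL] at hlen
  rw [hL] at hg
  have hVV := incl_conjTranspose_mul_incl h
  have hX : (incl n p)ᴴ * rotProd p ω (i :: j :: L)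
      = ω.1 i * (((incl n p)ᴴ * (ω.2 i : Mat p) * incl n p) *
          (ω.1 j * ((incl n p)ᴴ * ((ω.2 j : Mat p) * rotProd p ω L)))) := by
    simp only [rotProd, List.map_cons, List.prod_cons, embed_eq, Matrix.mul_assoc]
    rw [← Matrix.mul_assoc (incl n p)ᴴ (incl n p), hVV, Matrix.one_mul]
  rw [hX]
  have hc := cornerSize_nonneg (n := n) ω.2
  calc _ ≤ (1 + ‖ω.1 i‖) * (cornerSize n p ω.2 * ((1 + ‖ω.1 j‖) * (1 * (1 * gain ω.1 L)))) :=
        opNorm_mul_le_mul (by simp) <| opNorm_mul_le_mul (corner_le_cornerSize _ i) <|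
          opNorm_mul_le_mul (by simp) <| opNorm_mul_le_mul (opNorm_incl_conjTranspose_le h) <|
          opNorm_mul_le_mul (opNorm_unitary_le _) (opNorm_rotProd_le h ω L)
    _ = gain ω.1 (i :: j :: L) * cornerSize n p ω.2 := by
        simp only [gain, List.map_cons, List.prod_cons]; ring
    _ ≤ _ := mul_le_mul_of_nonneg_right hg hc

lemma rotTerm_empty (Q : NCPoly m n) (ω : (Fin m → Mat n) × (Fin m → UGroup p)) :
    Q.rotTerm p ω ∅ = Q.coeff ∅ * (incl n p)ᴴ := by
  simp [rotTerm, rotProd]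

lemma rotTerm_singleton (h : n ≤ p) (Q : NCPoly m n) (ω : (Fin m → Mat n) × (Fin m → UGroup p))
    (i : Fin m) :
    Q.rotTerm p ω {i} = Q.coeff {i} * (ω.1 i * ((incl n p)ᴴ * (ω.2 i : Mat p))) := by
  have : rotProd p ω (({i} : Finset (Fin m)).sort (· ≤ ·)) = embed p (ω.1 i) * (ω.2 i : Mat p) := by
    simp [rotProd]
  rw [rotTerm, this, embed_eq]
  simp only [Matrix.mul_assoc]
  rw [← Matrix.mul_assoc (incl n p)ᴴ (incl n p), incl_conjTranspose_mul_incl h, Matrix.one_mul]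

lemma opNorm_sandwich_le (A B X Y Z : Mat n) :
    ‖A * (X * (Z * (Yᴴ * Bᴴ)))‖ ≤ ‖A‖ * ‖B‖ * (‖X‖ * ‖Y‖ * ‖Z‖) := by
  have h1 := Matrix.l2_opNorm_mul A (X * (Z * (Yᴴ * Bᴴ)))
  have h2 := Matrix.l2_opNorm_mul X (Z * (Yᴴ * Bᴴ))
  have h3 := Matrix.l2_opNorm_mul Z (Yᴴ * Bᴴ)
  have h4 := Matrix.l2_opNorm_mul Yᴴ Bᴴ
  rw [Matrix.l2_opNorm_conjTranspose, Matrix.l2_opNorm_conjTranspose] at h4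
  calc _ ≤ ‖A‖ * (‖X‖ * (‖Z‖ * (‖Y‖ * ‖B‖))) := by
        refine h1.trans ?_; gcongr; refine h2.trans ?_; gcongr; refine h3.trans ?_; gcongr
    _ = _ := by ring

lemma norm_le_totalGain (G : Fin m → Mat n) (i : Fin m) : ‖G i‖ ≤ totalGain G := by
  have := gain_sort_le G {i}
  simp only [gain, Finset.sort_singleton, List.map_cons, List.map_nil, List.prod_cons,
    List.prod_nil, mul_one] at this
  linarith

/-- Apart from the diagonal terms of degree at most one, every term of `𝐐 𝐐*` contains a corner
of some `H_i` or of some `H_i H_j*`. -/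
lemma opNorm_rotTerm_mul_le (h : n ≤ p) (Q : NCPoly m n)
    (ω : (Fin m → Mat n) × (Fin m → UGroup p)) {S T : Finset (Fin m)}
    (hST : ¬ (S = T ∧ S.card ≤ 1)) :
    ‖Q.rotTerm p ω S * (Q.rotTerm p ω T)ᴴ‖
      ≤ ‖Q.coeff S‖ * ‖Q.coeff T‖ * (totalGain ω.1 ^ 2 * cornerSize n p ω.2) := by
  have hc := cornerSize_nonneg (n := n) ω.2
  have hg := one_le_totalGain ω.1
  have hmul := Matrix.l2_opNorm_mul (Q.rotTerm p ω S) (Q.rotTerm p ω T)ᴴ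
  rw [Matrix.l2_opNorm_conjTranspose] at hmul
  rcases Nat.lt_or_ge 1 S.card with hS | hS
  · refine hmul.trans ?_
    calc _ ≤ (‖Q.coeff S‖ * (totalGain ω.1 * cornerSize n p ω.2)) *
          (‖Q.coeff T‖ * totalGain ω.1) := by
          gcongr
          exacts [opNorm_rotTerm_le_of_two_le h Q ω hS, opNorm_rotTerm_le h Q ω T]
      _ = _ := by ring
  rcases Nat.lt_or_ge 1 T.card with hT | hT
  · refine hmul.trans ?_
    calc _ ≤ (‖Q.coeff S‖ * totalGain ω.1) *
          (‖Q.coeff T‖ * (totalGain ω.1 * cornerSize n p ω.2)) := by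
          gcongr
          exacts [opNorm_rotTerm_le h Q ω S, opNorm_rotTerm_le_of_two_le h Q ω hT]
      _ = _ := by ring
  have hne : S ≠ T := fun hh => hST ⟨hh, hS⟩
  rcases Nat.le_one_iff_eq_zero_or_eq_one.mp hS with hS0 | hS1 <;>
    rcases Nat.le_one_iff_eq_zero_or_eq_one.mp hT with hT0 | hT1
  · exact absurd ((Finset.card_eq_zero.mp hS0).trans (Finset.card_eq_zero.mp hT0).symm) hne
  · obtain rfl := Finset.card_eq_zero.mp hS0
    obtain ⟨j, rfl⟩ := Finset.card_eq_one.mp hT1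
    have hX : Q.rotTerm p ω ∅ * (Q.rotTerm p ω {j})ᴴ
        = Q.coeff ∅ * (1 * (((incl n p)ᴴ * (ω.2 j : Mat p)ᴴ * incl n p) *
            ((ω.1 j)ᴴ * (Q.coeff {j})ᴴ))) := by
      rw [rotTerm_empty, rotTerm_singleton h]
      simp only [Matrix.conjTranspose_mul, Matrix.conjTranspose_conjTranspose, Matrix.mul_assoc,
        Matrix.one_mul]
    rw [hX]
    refine (opNorm_sandwich_le _ _ _ _ _).trans ?_
    change _ * (_ * _ * cornerNorm n (ω.2 j : Mat p)ᴴ) ≤ _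
    rw [cornerNorm_conjTranspose, sq]
    gcongr
    exacts [cornerNorm_nonneg _, opNorm_one_le.trans hg, norm_le_totalGain _ _,
      corner_le_cornerSize _ _]
  · obtain rfl := Finset.card_eq_zero.mp hT0
    obtain ⟨i, rfl⟩ := Finset.card_eq_one.mp hS1
    have hX : Q.rotTerm p ω {i} * (Q.rotTerm p ω ∅)ᴴ
        = Q.coeff {i} * (ω.1 i * (((incl n p)ᴴ * (ω.2 i : Mat p) * incl n p) *
            ((1 : Mat n)ᴴ * (Q.coeff ∅)ᴴ))) := by
      rw [rotTerm_empty, rotTerm_singleton h]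
      simp only [Matrix.conjTranspose_mul, Matrix.conjTranspose_conjTranspose, Matrix.mul_assoc,
        Matrix.one_mul, Matrix.conjTranspose_one]
    rw [hX]
    refine (opNorm_sandwich_le _ _ _ _ _).trans ?_
    change _ * (_ * _ * cornerNorm n (ω.2 i : Mat p)) ≤ _
    rw [sq]
    gcongr
    exacts [cornerNorm_nonneg _, norm_le_totalGain _ _, opNorm_one_le.trans hg,
      corner_le_cornerSize _ _]
  · obtain ⟨i, rfl⟩ := Finset.card_eq_one.mp hS1
    obtain ⟨j, rfl⟩ := Finset.card_eq_one.mp hT1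
    have hij : j ≠ i := fun hh => hne (by rw [hh])
    have hX : Q.rotTerm p ω {i} * (Q.rotTerm p ω {j})ᴴ
        = Q.coeff {i} * (ω.1 i * (((incl n p)ᴴ * ((ω.2 i : Mat p) * (ω.2 j : Mat p)ᴴ) * incl n p) *
            ((ω.1 j)ᴴ * (Q.coeff {j})ᴴ))) := by
      rw [rotTerm_singleton h, rotTerm_singleton h]
      simp only [Matrix.conjTranspose_mul, Matrix.conjTranspose_conjTranspose, Matrix.mul_assoc]
    rw [hX]
    refine (opNorm_sandwich_le _ _ _ _ _).trans ?_
    change _ * (_ * _ * cornerNorm n ((ω.2 i : Mat p) * (ω.2 j : Mat p)ᴴ)) ≤ _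
    rw [sq]
    gcongr
    exacts [cornerNorm_nonneg _, norm_le_totalGain _ _, norm_le_totalGain _ _,
      corner_mul_le_cornerSize _ hij]

end NCPoly

/-! ### Averages over the cube -/

namespace NCPoly

/-- The character `χ_S(σ) = ∏_{i ∈ S} σ_i`. -/
def signChar (S : Finset (Fin m)) (σ : Fin m → ℤˣ) : ℝ := ∏ i ∈ S, (((σ i : ℤˣ) : ℤ) : ℝ)

lemma evalSign_eq (Q : NCPoly m n) (σ : Fin m → ℤˣ) :
    Q.evalSign σ = ∑ S, signChar S σ • Q.coeff S := by
  rw [evalSign, eval]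
  refine Finset.sum_congr rfl fun S _ => ?_
  have h (L : List (Fin m)) :
      (L.map fun i => (((σ i : ℤˣ) : ℤ) : ℂ) • (1 : Mat n)).prod
        = (L.map fun i => (((σ i : ℤˣ) : ℤ) : ℝ)).prod • (1 : Mat n) := by
    induction L with
    | nil => simp
    | cons i L ih =>
      have hc : (((σ i : ℤˣ) : ℤ) : ℂ) • (1 : Mat n) = (((σ i : ℤˣ) : ℤ) : ℝ) • (1 : Mat n) := by
        ext a b
        simp [Matrix.smul_apply]
      rw [List.map_cons, List.prod_cons, ih, List.map_cons, List.prod_cons, hc,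
        smul_mul_smul_comm, one_mul]
  rw [h]
  have h2 : ((S.sort (· ≤ ·)).map fun i => (((σ i : ℤˣ) : ℤ) : ℝ)).prod = signChar S σ := by
    rw [signChar, Finset.prod, ← Multiset.prod_coe, ← Multiset.map_coe, Finset.sort_eq]
  rw [h2, Matrix.mul_smul, Matrix.mul_one]

lemma sum_signChar_mul (S T : Finset (Fin m)) :
    ∑ σ, signChar S σ * signChar T σ = if S = T then (2 : ℝ) ^ m else 0 := by
  classical
  let g : Fin m → ℤˣ → ℝ := fun i s =>
    (if i ∈ S then ((s : ℤ) : ℝ) else 1) * (if i ∈ T then ((s : ℤ) : ℝ) else 1)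
  have h1 (σ : Fin m → ℤˣ) : signChar S σ * signChar T σ = ∏ i, g i (σ i) := by
    simp only [signChar, g, Finset.prod_mul_distrib, Finset.prod_ite_mem, Finset.univ_inter]
  have h2 (i : Fin m) : ∑ s, g i s = if (i ∈ S ↔ i ∈ T) then 2 else 0 := by
    by_cases hS : i ∈ S <;> by_cases hT : i ∈ T <;> (simp [g, hS, hT, UnitsInt.univ]; try norm_num)
  have h3 : ∑ σ : Fin m → ℤˣ, ∏ i, g i (σ i) = ∏ i, ∑ s, g i s := by
    rw [Finset.prod_univ_sum, Fintype.piFinset_univ]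
  simp only [h1, h3, h2]
  split_ifs with hST
  · simp [hST]
  · obtain ⟨i, hi⟩ : ∃ i, ¬ (i ∈ S ↔ i ∈ T) := by
      by_contra hcon
      push Not at hcon
      exact hST (Finset.ext hcon)
    exact Finset.prod_eq_zero (Finset.mem_univ i) (if_neg hi)

/-- Parseval's identity on the cube, for matrix coefficients. -/
lemma sum_evalSign_mul_conjTranspose (Q : NCPoly m n) :
    ∑ σ, Q.evalSign σ * (Q.evalSign σ)ᴴ
      = (2 : ℝ) ^ m • ∑ S, Q.coeff S * (Q.coeff S)ᴴ := by
  have h (σ : Fin m → ℤˣ) : Q.evalSign σ * (Q.evalSign σ)ᴴ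
      = ∑ S, ∑ T, (signChar S σ * signChar T σ) • (Q.coeff S * (Q.coeff T)ᴴ) := by
    rw [evalSign_eq, Matrix.conjTranspose_sum, Finset.sum_mul_sum]
    refine Finset.sum_congr rfl fun S _ => Finset.sum_congr rfl fun T _ => ?_
    rw [Matrix.conjTranspose_smul, star_trivial, smul_mul_smul_comm]
  simp only [h]
  rw [Finset.sum_comm, Finset.smul_sum]
  refine Finset.sum_congr rfl fun S _ => ?_
  rw [Finset.sum_comm]
  simp only [← Finset.sum_smul, sum_signChar_mul]
  rw [Finset.sum_eq_single S]
  · simp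
  · intro T _ hT
    simp [hT.symm]
  · simp

lemma signExp_const_mul (c : ℝ) (f : (Fin m → ℤˣ) → ℝ) :
    signExp (fun σ => c * f σ) = c * signExp f := by
  simp only [signExp, ← Finset.mul_sum]
  ring

lemma signExp_trR_mul (Q : NCPoly m n) (P : Mat n) :
    signExp (fun σ => trR (Q.evalSign σ * (Q.evalSign σ)ᴴ * P))
      = trR ((∑ S, Q.coeff S * (Q.coeff S)ᴴ) * P) := by
  rw [signExp, ← trR_sum, ← Finset.sum_mul, sum_evalSign_mul_conjTranspose, smul_mul_assoc,
    trR_smul, ← mul_assoc, inv_mul_cancel₀ (by positivity), one_mul]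

lemma signExp_mabs_sq (Q : NCPoly m n) :
    signExp (fun σ => 1 / (n : ℝ) * trR (mabs (Q.evalSign σ) ^ 2))
      = 1 / (n : ℝ) * ∑ S, frobSq (Q.coeff S) := by
  have := signExp_trR_mul Q 1
  simp only [mul_one] at this
  simp only [mabs_sq, signExp_const_mul, this]
  simp only [trR_sum, trR_mul_conjTranspose]

/-- `∑_{|S| ≤ 1} Q̂(S) Q̂(S)*`, the mean of the part of `𝐐 𝐐*` that survives as `p → ∞`. -/
def lowGram (Q : NCPoly m n) : Mat n :=
  ∑ S with S.card ≤ 1, Q.coeff S * (Q.coeff S)ᴴ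

lemma posSemidef_lowGram (Q : NCPoly m n) : Q.lowGram.PosSemidef :=
  Matrix.posSemidef_sum _ fun _ _ => Matrix.posSemidef_self_mul_conjTranspose _

/-- Jensen's inequality on the cube: `lowGram` lies below the mean of `Q(b) Q(b)*`. -/
lemma trR_psi_lowGram_le (Q : NCPoly m n) :
    trR (cfc psi Q.lowGram)
      ≤ signExp (fun σ => trR (cfc psi (Q.evalSign σ * (Q.evalSign σ)ᴴ))) := by
  obtain ⟨P, hP, hPeq⟩ := exists_effect_trR_psi_eq Q.posSemidef_lowGram
  have h1 : signExp (fun σ => trR ((Q.evalSign σ * (Q.evalSign σ)ᴴ - 1) * P))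
      ≤ signExp (fun σ => trR (cfc psi (Q.evalSign σ * (Q.evalSign σ)ᴴ))) := by
    refine mul_le_mul_of_nonneg_left (Finset.sum_le_sum fun σ _ => ?_) (by positivity)
    exact trR_sub_one_mul_le (Matrix.posSemidef_self_mul_conjTranspose _) hP
  refine le_trans ?_ h1
  have h2 : signExp (fun σ => trR ((Q.evalSign σ * (Q.evalSign σ)ᴴ - 1) * P))
      = trR ((∑ S, Q.coeff S * (Q.coeff S)ᴴ) * P) - trR P := by
    rw [← signExp_trR_mul]
    simp only [sub_mul, trR_sub, signExp, Finset.sum_sub_distrib, mul_sub, one_mul]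
    simp
  have h3 : (∑ S, Q.coeff S * (Q.coeff S)ᴴ)
      = Q.lowGram + ∑ S with ¬ S.card ≤ 1, Q.coeff S * (Q.coeff S)ᴴ :=
    (Finset.sum_filter_add_sum_filter_not _ _ _).symm
  have h4 : 0 ≤ trR ((∑ S with ¬ S.card ≤ 1, Q.coeff S * (Q.coeff S)ᴴ) * P) :=
    trR_mul_nonneg (Matrix.posSemidef_sum _ fun _ _ =>
      Matrix.posSemidef_self_mul_conjTranspose _) hP.posSemidef
  rw [h2, hPeq, h3, add_mul, trR_add, sub_mul, trR_sub, one_mul]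
  linarith

lemma sum_card_le_one {M : Type*} [AddCommMonoid M] (f : Finset (Fin m) → M) :
    ∑ S with S.card ≤ 1, f S = f ∅ + ∑ i, f {i} := by
  have h : (Finset.univ.filter fun S : Finset (Fin m) => S.card ≤ 1)
      = insert ∅ (Finset.univ.map ⟨fun i => {i}, Finset.singleton_injective⟩) := by
    ext S
    simp only [Finset.mem_filter, Finset.mem_univ, true_and, Finset.mem_insert, Finset.mem_map,
      Function.Embedding.coeFn_mk]
    rw [Nat.le_one_iff_eq_zero_or_eq_one, Finset.card_eq_zero, Finset.card_eq_one]
    simp only [eq_comm]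
  rw [h, Finset.sum_insert (by simp), Finset.sum_map]
  rfl

/-- `Q̂(∅) Q̂(∅)* + ∑ᵢ Q̂({i}) Gᵢ Gᵢ* Q̂({i})*`, written through the terms of degree at most one. -/
def lowRotGram (p : ℕ) (Q : NCPoly m n) (ω : (Fin m → Mat n) × (Fin m → UGroup p)) : Mat n :=
  ∑ S with S.card ≤ 1, Q.rotTerm p ω S * (Q.rotTerm p ω S)ᴴ

lemma lowRotGram_sub_lowGram (h : n ≤ p) (Q : NCPoly m n)
    (ω : (Fin m → Mat n) × (Fin m → UGroup p)) :
    Q.lowRotGram p ω - Q.lowGram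
      = ∑ i, Q.coeff {i} * (ω.1 i * (ω.1 i)ᴴ) * (Q.coeff {i})ᴴ
        - ∑ i, Q.coeff {i} * (Q.coeff {i})ᴴ := by
  have hVV := incl_conjTranspose_mul_incl h
  have h0 : Q.rotTerm p ω ∅ * (Q.rotTerm p ω ∅)ᴴ = Q.coeff ∅ * (Q.coeff ∅)ᴴ := by
    rw [rotTerm_empty, Matrix.conjTranspose_mul, Matrix.conjTranspose_conjTranspose,
      Matrix.mul_assoc, ← Matrix.mul_assoc _ (incl n p), hVV, Matrix.one_mul]
  have h1 (i : Fin m) : Q.rotTerm p ω {i} * (Q.rotTerm p ω {i})ᴴ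
      = Q.coeff {i} * (ω.1 i * (ω.1 i)ᴴ) * (Q.coeff {i})ᴴ := by
    rw [rotTerm_singleton h]
    simp only [Matrix.conjTranspose_mul, Matrix.conjTranspose_conjTranspose, Matrix.mul_assoc]
    rw [← Matrix.mul_assoc (ω.2 i : Mat p), self_mul_conjTranspose_unitary, Matrix.one_mul,
      ← Matrix.mul_assoc (incl n p)ᴴ (incl n p), hVV, Matrix.one_mul]
  rw [lowRotGram, lowGram, sum_card_le_one, sum_card_le_one, h0]
  simp only [h1]
  abel

/-! ### Deterministic comparison -/

lemma influence_eq (Q : NCPoly m n) (i : Fin m) :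
    Q.influence i = ∑ S : Finset (Fin m) with i ∈ S, frobSq (Q.coeff S) := by
  simp only [influence, trR_mul_conjTranspose]

lemma influence_nonneg (Q : NCPoly m n) (i : Fin m) : 0 ≤ Q.influence i := by
  rw [influence_eq]; exact Finset.sum_nonneg fun _ _ => frobSq_nonneg _

lemma influence_le_maxInfluence (Q : NCPoly m n) (i : Fin m) : Q.influence i ≤ Q.maxInfluence :=
  le_ciSup (Set.finite_range _).bddAbove i

lemma maxInfluence_nonneg (Q : NCPoly m n) : 0 ≤ Q.maxInfluence :=
  Real.iSup_nonneg fun i => Q.influence_nonneg i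

lemma maxInfluence_le (Q : NCPoly m n) : Q.maxInfluence ≤ ∑ S, frobSq (Q.coeff S) := by
  refine Real.iSup_le (fun i => ?_) (Finset.sum_nonneg fun _ _ => frobSq_nonneg _)
  rw [influence_eq]
  exact Finset.sum_le_sum_of_subset_of_nonneg (Finset.subset_univ _) fun _ _ _ => frobSq_nonneg _

lemma frobSq_coeff_le_maxInfluence (Q : NCPoly m n) {S : Finset (Fin m)} (hS : S.Nonempty) :
    frobSq (Q.coeff S) ≤ Q.maxInfluence := by
  obtain ⟨i, hi⟩ := hS
  refine le_trans ?_ (Q.influence_le_maxInfluence i)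
  rw [influence_eq]
  exact Finset.single_le_sum (f := fun S => frobSq (Q.coeff S)) (fun _ _ => frobSq_nonneg _)
    (Finset.mem_filter.mpr ⟨Finset.mem_univ S, hi⟩)

lemma opNorm_coeff_le (Q : NCPoly m n) (hQ : ∑ S, frobSq (Q.coeff S) ≤ n)
    (S : Finset (Fin m)) : ‖Q.coeff S‖ ≤ √n := by
  refine Real.le_sqrt_of_sq_le ((opNorm_sq_le_frobSq _).trans (le_trans ?_ hQ))
  exact Finset.single_le_sum (f := fun S => frobSq (Q.coeff S)) (fun _ _ => frobSq_nonneg _)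
    (Finset.mem_univ S)

lemma opNorm_coeff_le_of_nonempty (Q : NCPoly m n) {S : Finset (Fin m)} (hS : S.Nonempty) :
    ‖Q.coeff S‖ ≤ √Q.maxInfluence :=
  Real.le_sqrt_of_sq_le ((opNorm_sq_le_frobSq _).trans (Q.frobSq_coeff_le_maxInfluence hS))

/-- The factor `√τ` arises because at least one of `S`, `T` is nonempty in every term that is not
cancelled; it makes the bound vanish when `τ = 0`. -/
lemma opNorm_rotGram_sub_le (h : n ≤ p) (Q : NCPoly m n) (hQ : ∑ S, frobSq (Q.coeff S) ≤ n)
    (ω : (Fin m → Mat n) × (Fin m → UGroup p)) :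
    ‖Q.rotGram p ω - Q.lowRotGram p ω‖
      ≤ 4 ^ m * (√Q.maxInfluence * √n) * (totalGain ω.1 ^ 2 * cornerSize n p ω.2) := by
  have hc := cornerSize_nonneg (n := n) ω.2
  have hdiff : Q.rotGram p ω - Q.lowRotGram p ω
      = ∑ S, ∑ T, if S = T ∧ S.card ≤ 1 then 0 else Q.rotTerm p ω S * (Q.rotTerm p ω T)ᴴ := by
    have h1 : Q.lowRotGram p ω
        = ∑ S, ∑ T, if S = T ∧ S.card ≤ 1 then Q.rotTerm p ω S * (Q.rotTerm p ω T)ᴴ else 0 := by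
      rw [lowRotGram, Finset.sum_filter]
      refine Finset.sum_congr rfl fun S _ => ?_
      rw [Finset.sum_eq_single S]
      · simp
      · intro T _ hT
        rw [if_neg fun hh => hT hh.1.symm]
      · simp
    rw [rotGram, Matrix.conjTranspose_sum, Matrix.sum_mul, h1, ← Finset.sum_sub_distrib]
    refine Finset.sum_congr rfl fun S _ => ?_
    rw [Matrix.mul_sum, ← Finset.sum_sub_distrib]
    refine Finset.sum_congr rfl fun T _ => ?_
    split_ifs <;> simp
  have hterm (S T : Finset (Fin m)) :
      ‖if S = T ∧ S.card ≤ 1 then (0 : Mat n) else Q.rotTerm p ω S * (Q.rotTerm p ω T)ᴴ‖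
        ≤ (√Q.maxInfluence * √n) * (totalGain ω.1 ^ 2 * cornerSize n p ω.2) := by
    split_ifs with hST
    · rw [norm_zero]; positivity
    refine (opNorm_rotTerm_mul_le h Q ω hST).trans (mul_le_mul_of_nonneg_right ?_ (by positivity))
    rcases S.eq_empty_or_nonempty with rfl | hS
    · have hT : T.Nonempty := by
        rw [Finset.nonempty_iff_ne_empty]
        rintro rfl
        exact hST (by simp)
      rw [mul_comm]
      exact mul_le_mul (Q.opNorm_coeff_le_of_nonempty hT) (Q.opNorm_coeff_le hQ _)
        (norm_nonneg _) (Real.sqrt_nonneg _)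
    · exact mul_le_mul (Q.opNorm_coeff_le_of_nonempty hS) (Q.opNorm_coeff_le hQ _)
        (norm_nonneg _) (Real.sqrt_nonneg _)
  rw [hdiff]
  refine (norm_sum_le_of_le _ fun S _ => norm_sum_le_of_le _ fun T _ => hterm S T).trans_eq ?_
  simp only [Finset.sum_const, Finset.card_univ, Fintype.card_finset, Fintype.card_fin,
    nsmul_eq_mul]
  push_cast
  rw [← mul_assoc, ← mul_pow]
  norm_num
  ring

/-- The pointwise estimate: `(1/n) Tr ψ(|𝐐|²)` exceeds its value at `lowGram` by at most an
operator norm that is small when the corners of the unitaries are, and a normalized Frobenius norm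
that is small when the influences are. -/
lemma trR_psi_evalRot_le (hn : 0 < n) (h : n ≤ p) (Q : NCPoly m n)
    (ω : (Fin m → Mat n) × (Fin m → UGroup p)) :
    1 / (n : ℝ) * trR (cfc psi (mabs (Q.evalRot p ω) ^ 2))
      ≤ 1 / (n : ℝ) * trR (cfc psi Q.lowGram) + ‖Q.rotGram p ω - Q.lowRotGram p ω‖
        + (√n)⁻¹ * √(frobSq (Q.lowRotGram p ω - Q.lowGram)) := by
  rw [mabs_sq, evalRot_mul_conjTranspose]
  obtain ⟨P, hP, hle⟩ := exists_effect_trR_psi_pad_le h (Q.posSemidef_rotGram ω)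
    Q.posSemidef_lowGram
  have h1 := trR_mul_effect_le_opNorm (Q.rotGram p ω - Q.lowRotGram p ω) hP
  have h2 := trR_mul_effect_le (Q.lowRotGram p ω - Q.lowGram) hP
  have h3 : trR ((Q.rotGram p ω - Q.lowGram) * P)
      = trR ((Q.rotGram p ω - Q.lowRotGram p ω) * P)
        + trR ((Q.lowRotGram p ω - Q.lowGram) * P) := by
    rw [← trR_add, ← add_mul, sub_add_sub_cancel]
  have hn' : (0 : ℝ) < n := by exact_mod_cast hn
  have hsq : √(n : ℝ) * √n = n := Real.mul_self_sqrt hn'.le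
  have hpos : 0 < √(n : ℝ) := Real.sqrt_pos.mpr hn'
  calc _ ≤ 1 / (n : ℝ) * (trR (cfc psi Q.lowGram) + (n * ‖Q.rotGram p ω - Q.lowRotGram p ω‖
        + √n * √(frobSq (Q.lowRotGram p ω - Q.lowGram)))) := by
        gcongr
        linarith
    _ = _ := by
        have : (√(n : ℝ))⁻¹ = 1 / n * √n := by
          field_simp; rw [sq, hsq]
        rw [this]
        field_simp
        ring

end NCPoly

/-! ### Corners of Haar unitaries -/

instance instSecondCountableTopologyMat (n : ℕ) : SecondCountableTopology (Mat n) :=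
  have : ProperSpace (Mat n) := FiniteDimensional.proper ℂ (Mat n)
  inferInstance

instance isProbabilityMeasure_haarUnitary (p : ℕ) : IsProbabilityMeasure (haarUnitary p) where
  measure_univ := by
    rw [haarUnitary, ← TopologicalSpace.PositiveCompacts.coe_top]
    exact Measure.haarMeasure_self

instance isMulLeftInvariant_haarUnitary (p : ℕ) : (haarUnitary p).IsMulLeftInvariant := by
  unfold haarUnitary; infer_instance

/-- The Cauchy–Schwarz bound of the mean of a function by its second moment. -/
lemma integral_le_sqrt_integral_sq {Ω : Type*} [MeasurableSpace Ω] {P : Measure Ω}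
    [IsProbabilityMeasure P] {f : Ω → ℝ} (hf : AEStronglyMeasurable f P)
    (hint : Integrable (fun ω => f ω ^ 2) P) : ∫ ω, f ω ∂P ≤ √(∫ ω, f ω ^ 2 ∂P) := by
  have h := ProbabilityTheory.variance_nonneg f P
  rw [ProbabilityTheory.variance_eq_sub ((memLp_two_iff_integrable_sq hf).mpr hint)] at h
  exact Real.le_sqrt_of_sq_le (by simpa using h)

/-- The permutation matrix of a transposition, as a unitary matrix. -/
def swapUnitary (b c : Fin p) : UGroup p :=
  ⟨(Equiv.swap b c).permMatrix ℂ, by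
    rw [Matrix.mem_unitaryGroup_iff, Matrix.star_eq_conjTranspose, Matrix.conjTranspose_permMatrix,
      ← Matrix.permMatrix_mul]
    simp⟩

lemma mul_swapUnitary_conjTranspose (N : Mat p) (a b c : Fin p) :
    (N * (swapUnitary b c : Mat p)ᴴ) a b = N a c := by
  have (x : Fin p) : Equiv.swap b c x = b ↔ x = c := by
    rw [Equiv.swap_apply_eq_iff, Equiv.swap_apply_left]
  simp [swapUnitary, Matrix.mul_apply, Equiv.Perm.permMatrix, PEquiv.toMatrix_apply, this]

lemma continuous_coe_unitary : Continuous fun H : UGroup p => (H : Mat p) := continuous_subtype_val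

lemma integrable_of_continuous {f : (Fin m → UGroup p) → ℝ} (hf : Continuous f) :
    Integrable f (Measure.pi fun _ => haarUnitary p) :=
  hf.integrable_of_hasCompactSupport (HasCompactSupport.of_compactSpace f)

/-- The entries of `F H_j*` have second moment `1 / p` when `F` does not depend on `H_j`: by
invariance all the entries in a row have the same second moment. -/
lemma integral_norm_sq_entry {F : (Fin m → UGroup p) → UGroup p} (hF : Continuous F) (j : Fin m)
    (hFj : ∀ g H, F (Pi.mulSingle j g * H) = F H) (a b : Fin p) :
    ∫ H, ‖((F H : Mat p) * (H j : Mat p)ᴴ) a b‖ ^ 2 ∂(Measure.pi fun _ => haarUnitary p)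
      = 1 / p := by
  set e : Fin p → ℝ := fun b =>
    ∫ H, ‖((F H : Mat p) * (H j : Mat p)ᴴ) a b‖ ^ 2 ∂(Measure.pi fun _ => haarUnitary p) with he
  have hcont (b : Fin p) : Continuous fun H : Fin m → UGroup p =>
      ‖((F H : Mat p) * (H j : Mat p)ᴴ) a b‖ ^ 2 := by
    have h1 : Continuous fun H : Fin m → UGroup p => ((F H : Mat p) * (H j : Mat p)ᴴ) :=
      (continuous_coe_unitary.comp hF).mul
        (continuous_coe_unitary.comp (continuous_apply j)).matrix_conjTranspose
    exact (h1.matrix_elem a b).norm.pow 2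
  have hpi : (Measure.pi fun _ : Fin m => haarUnitary p).IsMulLeftInvariant :=
    Measure.pi.isMulLeftInvariant (fun _ : Fin m => haarUnitary p)
  -- Left translation of `H_j` by a transposition permutes the columns of `F H_j*`.
  have hinv (c : Fin p) : e c = e b := by
    have h1 := integral_mul_left_eq_self (μ := Measure.pi fun _ : Fin m => haarUnitary p)
      (fun H => ‖((F H : Mat p) * (H j : Mat p)ᴴ) a b‖ ^ 2) (Pi.mulSingle j (swapUnitary b c))
    rw [he]
    simp only
    rw [← h1]
    refine integral_congr_ae (Filter.Eventually.of_forall fun H => ?_)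
    simp only [hFj, Pi.mul_apply, Pi.mulSingle_eq_same, Submonoid.coe_mul,
      Matrix.conjTranspose_mul]
    rw [← Matrix.mul_assoc, mul_swapUnitary_conjTranspose]
  have hsum : ∑ c, e c = 1 := by
    rw [he]
    simp only
    rw [← integral_finsetSum _ fun c _ => integrable_of_continuous (hcont c)]
    have h1 (H : Fin m → UGroup p) : ∑ c, ‖((F H : Mat p) * (H j : Mat p)ᴴ) a c‖ ^ 2 = 1 := by
      set N : Mat p := (F H : Mat p) * (H j : Mat p)ᴴ with hN
      have h2 : N * Nᴴ = 1 := by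
        rw [hN, Matrix.conjTranspose_mul, Matrix.conjTranspose_conjTranspose, Matrix.mul_assoc,
          ← Matrix.mul_assoc _ (H j : Mat p), conjTranspose_mul_self_unitary, Matrix.one_mul,
          self_mul_conjTranspose_unitary]
      have h3 := congrArg (fun M : Mat p => (M a a).re) h2
      simp only [Matrix.mul_apply, Matrix.conjTranspose_apply, Complex.re_sum,
        Matrix.one_apply_eq, Complex.one_re] at h3
      rw [← h3]
      refine Finset.sum_congr rfl fun c _ => ?_
      rw [← Complex.normSq_eq_norm_sq]
      simp [Complex.normSq_apply]
    simp [h1]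
  have hp : (p : ℝ) ≠ 0 := by
    have := b.pos
    positivity
  simp only [hinv, Finset.sum_const, Finset.card_univ, Fintype.card_fin, nsmul_eq_mul] at hsum
  rw [eq_div_iff hp, mul_comm]
  exact hsum

namespace NCPoly

lemma continuous_cornerNorm : Continuous fun A : Mat p => cornerNorm n A := by
  unfold cornerNorm
  exact ((continuous_const.matrix_mul continuous_id).matrix_mul continuous_const).norm

lemma integral_cornerNorm_le (h : n ≤ p) {F : (Fin m → UGroup p) → UGroup p} (hF : Continuous F)
    (j : Fin m) (hFj : ∀ g H, F (Pi.mulSingle j g * H) = F H) :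
    ∫ H, cornerNorm n ((F H : Mat p) * (H j : Mat p)ᴴ) ∂(Measure.pi fun _ => haarUnitary p)
      ≤ n * (√p)⁻¹ := by
  have hN : Continuous fun H : Fin m → UGroup p => ((F H : Mat p) * (H j : Mat p)ᴴ) :=
    (continuous_coe_unitary.comp hF).mul
      (continuous_coe_unitary.comp (continuous_apply j)).matrix_conjTranspose
  have hc := (continuous_cornerNorm (n := n)).comp hN
  refine (integral_le_sqrt_integral_sq hc.aestronglyMeasurable
    (integrable_of_continuous (hc.pow 2))).trans ?_
  have hent (a b : Fin p) : Integrable (fun H : Fin m → UGroup p =>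
      ‖((F H : Mat p) * (H j : Mat p)ᴴ) a b‖ ^ 2) (Measure.pi fun _ => haarUnitary p) :=
    integrable_of_continuous ((hN.matrix_elem a b).norm.pow 2)
  have h1 : ∫ H, cornerNorm n ((F H : Mat p) * (H j : Mat p)ᴴ) ^ 2
        ∂(Measure.pi fun _ => haarUnitary p)
      ≤ ∫ H, ∑ a : Fin n, ∑ b : Fin n,
          ‖((F H : Mat p) * (H j : Mat p)ᴴ) (Fin.castLE h a) (Fin.castLE h b)‖ ^ 2
        ∂(Measure.pi fun _ => haarUnitary p) := by
    refine integral_mono (integrable_of_continuous (hc.pow 2))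
      (integrable_finsetSum _ fun a _ => integrable_finsetSum _ fun b _ => hent _ _) fun H => ?_
    refine (opNorm_sq_le_frobSq _).trans_eq ?_
    simp only [frobSq, corner_apply h]
  have h2 : ∫ H, ∑ a : Fin n, ∑ b : Fin n,
          ‖((F H : Mat p) * (H j : Mat p)ᴴ) (Fin.castLE h a) (Fin.castLE h b)‖ ^ 2
        ∂(Measure.pi fun _ => haarUnitary p) = n ^ 2 * (p : ℝ)⁻¹ := by
    rw [integral_finsetSum _ fun a _ => integrable_finsetSum _ fun b _ => hent _ _]
    simp only [integral_finsetSum _ fun b _ => hent _ _, integral_norm_sq_entry hF j hFj]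
    simp
    ring
  refine (Real.sqrt_le_sqrt (h1.trans_eq h2)).trans_eq ?_
  rw [Real.sqrt_mul (by positivity), Real.sqrt_sq (by positivity), Real.sqrt_inv]

lemma continuous_cornerSize : Continuous fun H : Fin m → UGroup p => cornerSize n p H := by
  unfold cornerSize
  refine Continuous.add (continuous_finsetSum _ fun i _ => ?_)
    (continuous_finsetSum _ fun i _ => continuous_finsetSum _ fun j _ => ?_)
  · exact continuous_cornerNorm.comp (continuous_coe_unitary.comp (continuous_apply i))
  · exact continuous_cornerNorm.comp ((continuous_coe_unitary.comp (continuous_apply i)).mul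
      (continuous_coe_unitary.comp (continuous_apply j)).matrix_conjTranspose)

/-- The corners of independent Haar unitaries are of size `p ^ (-1/2)` on average. -/
lemma integral_cornerSize_le (h : n ≤ p) :
    ∫ H, cornerSize n p H ∂(Measure.pi fun _ : Fin m => haarUnitary p)
      ≤ (m + m ^ 2) * n * (√p)⁻¹ := by
  have hc1 (i : Fin m) : Continuous fun H : Fin m → UGroup p => cornerNorm n (H i : Mat p) :=
    continuous_cornerNorm.comp (continuous_coe_unitary.comp (continuous_apply i))
  have hc2 (i j : Fin m) : Continuous fun H : Fin m → UGroup p =>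
      cornerNorm n ((H i : Mat p) * (H j : Mat p)ᴴ) :=
    continuous_cornerNorm.comp ((continuous_coe_unitary.comp (continuous_apply i)).mul
      (continuous_coe_unitary.comp (continuous_apply j)).matrix_conjTranspose)
  unfold cornerSize
  rw [integral_add (integrable_finsetSum _ fun i _ => integrable_of_continuous (hc1 i))
      (integrable_finsetSum _ fun i _ => integrable_finsetSum _ fun j _ =>
        integrable_of_continuous (hc2 i j)),
    integral_finsetSum _ fun i _ => integrable_of_continuous (hc1 i),
    integral_finsetSum _ fun i _ => integrable_finsetSum _ fun j _ =>
      integrable_of_continuous (hc2 i j)]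
  have h1 (i : Fin m) : ∫ H, cornerNorm n (H i : Mat p) ∂(Measure.pi fun _ => haarUnitary p)
      ≤ n * (√p)⁻¹ := by
    have := integral_cornerNorm_le (m := m) h (F := fun _ => 1) continuous_const i (fun _ _ => rfl)
    simpa [cornerNorm_conjTranspose] using this
  have h2 (i : Fin m) : ∫ H, ∑ j with j ≠ i, cornerNorm n ((H i : Mat p) * (H j : Mat p)ᴴ)
        ∂(Measure.pi fun _ => haarUnitary p) ≤ m * (n * (√p)⁻¹) := by
    rw [integral_finsetSum _ fun j _ => integrable_of_continuous (hc2 i j)]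
    refine (Finset.sum_le_card_nsmul _ _ (n * (√p)⁻¹) fun j hj => ?_).trans ?_
    · have hij : j ≠ i := (Finset.mem_filter.mp hj).2
      refine integral_cornerNorm_le h (F := fun H => H i) (continuous_apply i) j fun g H => ?_
      simp [Pi.mulSingle_eq_of_ne hij.symm]
    · rw [nsmul_eq_mul]
      gcongr
      exact (Finset.card_le_univ _).trans_eq (Fintype.card_fin m)
  refine (add_le_add (Finset.sum_le_sum fun i _ => h1 i)
    (Finset.sum_le_sum fun i _ => h2 i)).trans_eq ?_
  simp
  ring

end NCPoly

/-! ### Moments of the ensemble -/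

lemma integrable_linearMap {Ω : Type*} [MeasurableSpace Ω] {P : Measure Ω} (L : Mat n →ₗ[ℝ] ℝ)
    {f : Ω → Mat n} (hf : Integrable f P) : Integrable (fun ω => L (f ω)) P :=
  (LinearMap.toContinuousLinearMap L).integrable_comp hf

lemma integral_linearMap {Ω : Type*} [MeasurableSpace Ω] {P : Measure Ω} (L : Mat n →ₗ[ℝ] ℝ)
    {f : Ω → Mat n} (hf : Integrable f P) : ∫ ω, L (f ω) ∂P = L (∫ ω, f ω ∂P) :=
  (LinearMap.toContinuousLinearMap L).integral_comp_comm hf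

/-- The real-linear functional `X ↦ Re Tr(A X B)`. -/
def trFunctional (A B : Mat n) : Mat n →ₗ[ℝ] ℝ where
  toFun X := trR (A * X * B)
  map_add' X Y := by rw [mul_add, add_mul, trR_add]
  map_smul' c X := by rw [mul_smul_comm, smul_mul_assoc, trR_smul]; rfl

/-- The real-linear functional `X ↦ Re (A X B)_{ab}`. -/
def reEntry (A B : Mat n) (a b : Fin n) : Mat n →ₗ[ℝ] ℝ where
  toFun X := ((A * X * B) a b).re
  map_add' X Y := by rw [mul_add, add_mul]; simp
  map_smul' c X := by rw [mul_smul_comm, smul_mul_assoc]; simp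

/-- The real-linear functional `X ↦ Im (A X B)_{ab}`. -/
def imEntry (A B : Mat n) (a b : Fin n) : Mat n →ₗ[ℝ] ℝ where
  toFun X := ((A * X * B) a b).im
  map_add' X Y := by rw [mul_add, add_mul]; simp
  map_smul' c X := by rw [mul_smul_comm, smul_mul_assoc]; simp

lemma frobSq_eq_re_im (A : Mat n) :
    frobSq A = ∑ a, ∑ b, ((A a b).re ^ 2 + (A a b).im ^ 2) := by
  refine Finset.sum_congr rfl fun a _ => Finset.sum_congr rfl fun b _ => ?_
  rw [← Complex.normSq_eq_norm_sq, Complex.normSq_apply]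
  ring

lemma opNorm_mul_conjTranspose_self (A : Mat n) : ‖A * Aᴴ‖ = ‖A‖ ^ 2 := by
  have := Matrix.l2_opNorm_conjTranspose_mul_self Aᴴ
  rwa [Matrix.conjTranspose_conjTranspose, Matrix.l2_opNorm_conjTranspose, ← sq] at this

lemma opNorm_gram_sq (A : Mat n) : ‖(A * Aᴴ) ^ 2‖ = ‖A * Aᴴ‖ ^ 2 := by
  have h := opNorm_mul_conjTranspose_self (A * Aᴴ)
  rwa [Matrix.conjTranspose_mul, Matrix.conjTranspose_conjTranspose, ← sq] at h

namespace IsEnsemble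

variable {μ : Measure (Mat n)}

lemma integrable_norm_sq (hμ : IsEnsemble μ) : Integrable (fun A : Mat n => ‖A‖ ^ 2) μ := by
  simpa only [opNorm_mul_conjTranspose_self] using hμ.integrable_sq.norm

/-- The operator norm is at most the Frobenius norm, and `E Tr G G* = Tr I = n`. -/
lemma integral_norm_sq_le (hμ : IsEnsemble μ) : ∫ A, ‖A‖ ^ 2 ∂μ ≤ n := by
  have h1 := integral_linearMap (trFunctional (1 : Mat n) 1) hμ.integrable_sq
  have h2 := integrable_linearMap (trFunctional (1 : Mat n) 1) hμ.integrable_sq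
  rw [hμ.covariance] at h1
  simp only [trFunctional, LinearMap.coe_mk, AddHom.coe_mk, one_mul, mul_one,
    trR_mul_conjTranspose] at h1 h2
  have h3 : trR (1 : Mat n) = n := by simp [trR]
  rw [← h3, ← h1]
  exact integral_mono hμ.integrable_norm_sq h2 fun A => opNorm_sq_le_frobSq A

lemma integrable_one_add_norm_sq (hμ : IsEnsemble μ) :
    Integrable (fun A : Mat n => (1 + ‖A‖) ^ 2) μ := by
  have := hμ.isProbabilityMeasure
  have h : (fun A : Mat n => (1 + ‖A‖) ^ 2) = fun A => 1 + 2 * ‖A‖ + ‖A‖ ^ 2 := by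
    funext A; ring
  rw [h]
  exact ((integrable_const 1).add (hμ.integrable.norm.const_mul 2)).add hμ.integrable_norm_sq

lemma integral_one_add_norm_sq_le (hμ : IsEnsemble μ) :
    ∫ A, (1 + ‖A‖) ^ 2 ∂μ ≤ (2 + 2 * n : ℝ) := by
  have := hμ.isProbabilityMeasure
  have h1 : ∫ A, (1 + ‖A‖) ^ 2 ∂μ ≤ ∫ A, ((2 : ℝ) + 2 * ‖A‖ ^ 2) ∂μ :=
    integral_mono hμ.integrable_one_add_norm_sq
      ((integrable_const 2).add (hμ.integrable_norm_sq.const_mul 2))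
      fun A => by nlinarith [sq_nonneg (1 - ‖A‖)]
  rw [integral_add (integrable_const 2) (hμ.integrable_norm_sq.const_mul 2),
    integral_const_mul] at h1
  have h2 := hμ.integral_norm_sq_le
  simp only [integral_const, probReal_univ, smul_eq_mul, one_mul] at h1
  linarith

lemma totalGain_sq (G : Fin m → Mat n) :
    NCPoly.totalGain G ^ 2 = ∏ i, (1 + ‖G i‖) ^ 2 := by
  rw [NCPoly.totalGain, Finset.prod_pow]

lemma integrable_totalGain_sq (hμ : IsEnsemble μ) :
    Integrable (fun G : Fin m → Mat n => NCPoly.totalGain G ^ 2) (Measure.pi fun _ => μ) := by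
  have := hμ.isProbabilityMeasure
  simp only [totalGain_sq]
  exact Integrable.fintype_prod (f := fun _ A => (1 + ‖A‖) ^ 2)
    fun _ => hμ.integrable_one_add_norm_sq

lemma integral_totalGain_sq_le (hμ : IsEnsemble μ) :
    ∫ G : Fin m → Mat n, NCPoly.totalGain G ^ 2 ∂(Measure.pi fun _ => μ) ≤ (2 + 2 * n) ^ m := by
  have := hμ.isProbabilityMeasure
  simp only [totalGain_sq]
  rw [integral_fintype_prod_eq_prod (fun _ (A : Mat n) => (1 + ‖A‖) ^ 2)]
  simp only [Finset.prod_const, Finset.card_univ, Fintype.card_fin]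
  exact pow_le_pow_left₀ (integral_nonneg fun A => by positivity) hμ.integral_one_add_norm_sq_le m

lemma memLp_linearMap (hμ : IsEnsemble μ) (h4 : Integrable (fun A : Mat n => (A * Aᴴ) ^ 2) μ)
    (L : Mat n →ₗ[ℝ] ℝ) : MemLp (fun A => L (A * Aᴴ)) 2 μ := by
  have h1 : MemLp (fun A : Mat n => A * Aᴴ) 2 μ := by
    refine (memLp_two_iff_integrable_sq_norm hμ.integrable_sq.aestronglyMeasurable).mpr ?_
    simpa only [opNorm_gram_sq] using h4.norm
  exact (LinearMap.toContinuousLinearMap L).comp_memLp' h1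

/-- The variance of a sum of independent terms is at most the sum of the second moments. -/
lemma integral_sum_sub_sq_le (hμ : IsEnsemble μ)
    (h4 : Integrable (fun A : Mat n => (A * Aᴴ) ^ 2) μ) (L : Fin m → Mat n →ₗ[ℝ] ℝ) :
    Integrable (fun G : Fin m → Mat n => (∑ i, L i (G i * (G i)ᴴ) - ∑ i, L i 1) ^ 2)
        (Measure.pi fun _ => μ) ∧
      ∫ G : Fin m → Mat n, (∑ i, L i (G i * (G i)ᴴ) - ∑ i, L i 1) ^ 2 ∂(Measure.pi fun _ => μ)
        ≤ ∑ i, ∫ A, L i (A * Aᴴ) ^ 2 ∂μ := by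
  have := hμ.isProbabilityMeasure
  have hX (i : Fin m) := hμ.memLp_linearMap h4 (L i)
  have hXpi (i : Fin m) : MemLp (fun G : Fin m → Mat n => L i (G i * (G i)ᴴ)) 2
      (Measure.pi fun _ => μ) :=
    (hX i).comp_measurePreserving (measurePreserving_eval (fun _ : Fin m => μ) i)
  have hsum : MemLp (fun G : Fin m → Mat n => ∑ i, L i (G i * (G i)ᴴ)) 2
      (Measure.pi fun _ => μ) := memLp_finsetSum _ fun i _ => hXpi i
  have hmean : ∫ G : Fin m → Mat n, ∑ i, L i (G i * (G i)ᴴ) ∂(Measure.pi fun _ => μ)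
      = ∑ i, L i 1 := by
    rw [integral_finsetSum _ fun i _ => (hXpi i).integrable one_le_two]
    refine Finset.sum_congr rfl fun i _ => ?_
    rw [integral_comp_eval (μ := fun _ : Fin m => μ) (f := fun A => L i (A * Aᴴ))
      (hX i).aestronglyMeasurable, integral_linearMap _ hμ.integrable_sq, hμ.covariance]
  refine ⟨(hsum.sub (memLp_const _)).integrable_sq, ?_⟩
  have hvar := ProbabilityTheory.variance_sum_pi (μ := fun _ : Fin m => μ) hX
  have hfun : (∑ i, fun G : Fin m → Mat n => L i (G i * (G i)ᴴ))
      = fun G => ∑ i, L i (G i * (G i)ᴴ) := by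
    funext G; simp
  rw [hfun, ProbabilityTheory.variance_eq_integral hsum.aestronglyMeasurable.aemeasurable,
    hmean] at hvar
  rw [hvar]
  exact Finset.sum_le_sum fun i _ =>
    ProbabilityTheory.variance_le_expectation_sq (hX i).aestronglyMeasurable

/-- The fourth moment of `B G`: `‖B Y B*‖_F² ≤ ‖B‖_F² Tr(B Y² B*)` for `Y = G G*`, which is linear
in `Y²`. -/
lemma integral_frobSq_conj_le
    (h4 : Integrable (fun A : Mat n => (A * Aᴴ) ^ 2) μ) {c : ℝ}
    (hc : ‖∫ A, (A * Aᴴ) ^ 2 ∂μ‖ ≤ c) (B : Mat n) :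
    ∫ A, frobSq (B * (A * Aᴴ) * Bᴴ) ∂μ ≤ c * frobSq B ^ 2 := by
  have hpt (A : Mat n) : frobSq (B * (A * Aᴴ) * Bᴴ)
      ≤ frobSq B * trFunctional B Bᴴ ((A * Aᴴ) ^ 2) := by
    have h1 := frobSq_mul_le (B * (A * Aᴴ)) Bᴴ
    rw [Matrix.l2_opNorm_conjTranspose] at h1
    have h2 : frobSq (B * (A * Aᴴ)) = trFunctional B Bᴴ ((A * Aᴴ) ^ 2) := by
      rw [← trR_mul_conjTranspose]
      simp only [trFunctional, LinearMap.coe_mk, AddHom.coe_mk, Matrix.conjTranspose_mul,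
        Matrix.conjTranspose_conjTranspose, sq, Matrix.mul_assoc]
    rw [← h2, mul_comm]
    exact h1.trans (mul_le_mul_of_nonneg_left (opNorm_sq_le_frobSq B) (frobSq_nonneg _))
  have hint := (integrable_linearMap (trFunctional B Bᴴ) h4).const_mul (frobSq B)
  have h3 : ∫ A, frobSq (B * (A * Aᴴ) * Bᴴ) ∂μ
      ≤ frobSq B * trFunctional B Bᴴ (∫ A, (A * Aᴴ) ^ 2 ∂μ) := by
    rw [← integral_linearMap _ h4, ← integral_const_mul]
    exact integral_mono_of_nonneg (Filter.Eventually.of_forall fun A => frobSq_nonneg _) hint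
      (Filter.Eventually.of_forall hpt)
  set Z := ∫ A, (A * Aᴴ) ^ 2 ∂μ
  have h4 : trFunctional B Bᴴ Z ≤ ‖Z‖ * frobSq B := by
    refine (trR_mul_le (B * Z) Bᴴ).trans ?_
    rw [frobSq_conjTranspose, ← Real.sqrt_mul (frobSq_nonneg _)]
    refine Real.sqrt_le_iff.mpr ⟨mul_nonneg (norm_nonneg _) (frobSq_nonneg _), ?_⟩
    have := mul_le_mul_of_nonneg_right (frobSq_mul_le B Z) (frobSq_nonneg B)
    linarith
  calc _ ≤ frobSq B * (‖Z‖ * frobSq B) :=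
        h3.trans (mul_le_mul_of_nonneg_left h4 (frobSq_nonneg B))
    _ ≤ frobSq B * (c * frobSq B) := by
        have := frobSq_nonneg B
        gcongr
    _ = c * frobSq B ^ 2 := by ring

/-- Independence makes `∑ᵢ Bᵢ (Gᵢ Gᵢ* - 1) Bᵢ*` small in mean square as soon as no single `Bᵢ`
is large. -/
lemma integral_frobSq_sum_sub_le (hμ : IsEnsemble μ)
    (h4 : Integrable (fun A : Mat n => (A * Aᴴ) ^ 2) μ) {c : ℝ}
    (hc : ‖∫ A, (A * Aᴴ) ^ 2 ∂μ‖ ≤ c) (B : Fin m → Mat n) :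
    Integrable (fun G : Fin m → Mat n =>
        frobSq (∑ i, B i * (G i * (G i)ᴴ) * (B i)ᴴ - ∑ i, B i * (B i)ᴴ))
        (Measure.pi fun _ => μ) ∧
      ∫ G : Fin m → Mat n, frobSq (∑ i, B i * (G i * (G i)ᴴ) * (B i)ᴴ - ∑ i, B i * (B i)ᴴ)
        ∂(Measure.pi fun _ => μ) ≤ ∑ i, c * frobSq (B i) ^ 2 := by
  have hre (a b : Fin n) := hμ.integral_sum_sub_sq_le h4 fun i => reEntry (B i) (B i)ᴴ a b
  have him (a b : Fin n) := hμ.integral_sum_sub_sq_le h4 fun i => imEntry (B i) (B i)ᴴ a b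
  have hexp (G : Fin m → Mat n) :
      frobSq (∑ i, B i * (G i * (G i)ᴴ) * (B i)ᴴ - ∑ i, B i * (B i)ᴴ)
        = ∑ a, ∑ b,
          ((∑ i, reEntry (B i) (B i)ᴴ a b (G i * (G i)ᴴ) - ∑ i, reEntry (B i) (B i)ᴴ a b 1) ^ 2
          + (∑ i, imEntry (B i) (B i)ᴴ a b (G i * (G i)ᴴ)
              - ∑ i, imEntry (B i) (B i)ᴴ a b 1) ^ 2) := by
    rw [frobSq_eq_re_im]
    simp only [reEntry, imEntry, LinearMap.coe_mk, AddHom.coe_mk, mul_one, Matrix.sub_apply,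
      Matrix.sum_apply, Complex.sub_re, Complex.sub_im, Complex.re_sum, Complex.im_sum]
  simp only [hexp]
  have hab (a b : Fin n) := (hre a b).1.add (him a b).1
  refine ⟨integrable_finsetSum _ fun a _ => integrable_finsetSum _ fun b _ => hab a b, ?_⟩
  have hmre (i : Fin m) (a b : Fin n) :=
    (hμ.memLp_linearMap h4 (reEntry (B i) (B i)ᴴ a b)).integrable_sq
  have hmim (i : Fin m) (a b : Fin n) :=
    (hμ.memLp_linearMap h4 (imEntry (B i) (B i)ᴴ a b)).integrable_sq
  have hsingle (i : Fin m) : ∑ a, ∑ b, (∫ A, reEntry (B i) (B i)ᴴ a b (A * Aᴴ) ^ 2 ∂μ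
        + ∫ A, imEntry (B i) (B i)ᴴ a b (A * Aᴴ) ^ 2 ∂μ)
      = ∫ A, frobSq (B i * (A * Aᴴ) * (B i)ᴴ) ∂μ := by
    simp only [frobSq_eq_re_im]
    rw [integral_finsetSum]
    · refine Finset.sum_congr rfl fun a _ => ?_
      rw [integral_finsetSum]
      · refine Finset.sum_congr rfl fun b _ => ?_
        exact (integral_add (hmre i a b) (hmim i a b)).symm
      · exact fun b _ => (hmre i a b).add (hmim i a b)
    · exact fun a _ => integrable_finsetSum _ fun b _ => (hmre i a b).add (hmim i a b)
  have hcoord (a b : Fin n) := (integral_add (hre a b).1 (him a b).1).trans_le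
    (add_le_add (hre a b).2 (him a b).2)
  have hle : ∑ a, ∑ b, (∑ i, ∫ A, reEntry (B i) (B i)ᴴ a b (A * Aᴴ) ^ 2 ∂μ
        + ∑ i, ∫ A, imEntry (B i) (B i)ᴴ a b (A * Aᴴ) ^ 2 ∂μ)
      = ∑ i, ∫ A, frobSq (B i * (A * Aᴴ) * (B i)ᴴ) ∂μ := by
    simp only [← hsingle, ← Finset.sum_add_distrib]
    exact (Finset.sum_congr rfl fun a _ => Finset.sum_comm).trans Finset.sum_comm
  refine le_trans ?_ (hle.trans_le
    (Finset.sum_le_sum fun i _ => integral_frobSq_conj_le h4 hc (B i)))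
  rw [integral_finsetSum]
  · refine Finset.sum_le_sum fun a _ => ?_
    rw [integral_finsetSum]
    · exact Finset.sum_le_sum fun b _ => hcoord a b
    · exact fun b _ => hab a b
  · exact fun a _ => integrable_finsetSum _ fun b _ => hab a b

end IsEnsemble

/-! ### The expectation bound -/

namespace NCPoly

lemma degree_pos (Q : NCPoly m n) (hτ : 0 < Q.maxInfluence) : 0 < Q.degree := by
  classical
  by_contra hd
  have hcoeff (S : Finset (Fin m)) (hS : S.Nonempty) : Q.coeff S = 0 := by
    by_contra hne
    have h1 : S.card ≤ Q.degree := by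
      unfold degree
      exact Finset.le_sup (f := Finset.card)
        (Finset.mem_filter.mpr ⟨Finset.mem_univ S, hne⟩)
    have := hS.card_pos
    omega
  have hle : Q.maxInfluence ≤ 0 := by
    refine Real.iSup_le (fun i => ?_) le_rfl
    rw [influence_eq]
    refine (Finset.sum_eq_zero fun S hS => ?_).le
    rw [hcoeff S ⟨i, (Finset.mem_filter.mp hS).2⟩]
    simp [frobSq]
  linarith

/-- Converts the bound `√(c₂ τ)` of the mean-square estimate, using `τ ≤ n`. -/
lemma sqrt_mul_maxInfluence_le (hn : 0 < n) (Q : NCPoly m n) (hτn : Q.maxInfluence ≤ n)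
    {c₂ c₃ : ℝ} (h₂ : 1 ≤ c₂) (h₃ : 1 ≤ c₃) :
    √(c₂ * Q.maxInfluence)
      ≤ (n : ℝ) ^ (1 / 2 : ℝ) * (8 * c₂ * c₃) ^ (9 * Q.degree) * Q.maxInfluence ^ (1 / 6 : ℝ) := by
  rcases Q.maxInfluence_nonneg.eq_or_lt with h0 | hpos
  · rw [← h0, mul_zero, Real.sqrt_zero]
    positivity
  have hd := Q.degree_pos hpos
  set τ := Q.maxInfluence
  have hn1 : (1 : ℝ) ≤ n := by exact_mod_cast hn
  have hbase : c₂ ≤ 8 * c₂ * c₃ := by nlinarith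
  have hc : √c₂ ≤ (8 * c₂ * c₃) ^ (9 * Q.degree) :=
    calc √c₂ ≤ c₂ := Real.sqrt_le_iff.mpr ⟨by linarith, by nlinarith⟩
      _ ≤ 8 * c₂ * c₃ := hbase
      _ ≤ _ := le_self_pow₀ (h₂.trans hbase) (by omega)
  have hτ : √τ ≤ (n : ℝ) ^ (1 / 2 : ℝ) * τ ^ (1 / 6 : ℝ) :=
    calc √τ = τ ^ (1 / 3 : ℝ) * τ ^ (1 / 6 : ℝ) := by
          rw [Real.sqrt_eq_rpow, ← Real.rpow_add hpos]; norm_num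
      _ ≤ (n : ℝ) ^ (1 / 3 : ℝ) * τ ^ (1 / 6 : ℝ) := by gcongr
      _ ≤ _ := by gcongr; norm_num
  calc √(c₂ * τ) = √c₂ * √τ := Real.sqrt_mul (by linarith) _
    _ ≤ (8 * c₂ * c₃) ^ (9 * Q.degree) * ((n : ℝ) ^ (1 / 2 : ℝ) * τ ^ (1 / 6 : ℝ)) := by gcongr
    _ = _ := by ring

/-- Produces the factor `τ ^ (-1/3)`, using `τ ≤ n`. When `τ = 0` both sides are `0`, by the
convention `0 ^ (-1/3) = 0`. -/
lemma sqrt_maxInfluence_le (Q : NCPoly m n) (hτn : Q.maxInfluence ≤ n) :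
    √Q.maxInfluence ≤ (n : ℝ) ^ (5 / 6 : ℝ) * Q.maxInfluence ^ (-(1 / 3) : ℝ) := by
  rcases Q.maxInfluence_nonneg.eq_or_lt with h0 | hpos
  · rw [← h0, Real.sqrt_zero]
    positivity
  · calc √Q.maxInfluence = Q.maxInfluence ^ (5 / 6 : ℝ) * Q.maxInfluence ^ (-(1 / 3) : ℝ) := by
          rw [Real.sqrt_eq_rpow, ← Real.rpow_add hpos]; norm_num
      _ ≤ _ := by gcongr

lemma continuous_evalRot (Q : NCPoly m n) :
    Continuous fun ω : (Fin m → Mat n) × (Fin m → UGroup p) => Q.evalRot p ω := by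
  unfold evalRot eval
  refine continuous_finsetSum _ fun S _ => continuous_const.mul ?_
  refine continuous_list_prod _ fun i _ => Continuous.mul ?_ ?_
  · simp only [embed_eq]
    exact (continuous_const.matrix_mul ((continuous_apply i).comp continuous_fst)).matrix_mul
      continuous_const
  · exact continuous_coe_unitary.comp ((continuous_apply i).comp continuous_snd)

/-- A constant for the part of the error that comes from the finite size of the unitaries: `4 ^ m`
pairs of coefficients of size `√τ √n` each, with `√τ ≤ n ^ (5/6) τ ^ (-1/3)`, times the bounds for
the means of `totalGain ^ 2` and of `√p` times `cornerSize`. -/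
def finiteSizeConst (m n : ℕ) : ℝ :=
  4 ^ m * ((n : ℝ) ^ (5 / 6 : ℝ) * √n) * ((2 + 2 * n) ^ m * ((m + m ^ 2) * n))

lemma trR_psi_gram_eq_zero {A : Mat n} (hA : ‖A‖ ≤ 1) : trR (cfc psi (A * Aᴴ)) = 0 := by
  refine trR_psi_eq_zero (Matrix.posSemidef_self_mul_conjTranspose A) ?_
  rw [opNorm_mul_conjTranspose_self]
  exact pow_le_one₀ (norm_nonneg _) hA

section Integrals

variable {μ : Measure (Mat n)}

instance isProbabilityMeasure_inputLaw [IsProbabilityMeasure μ] :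
    IsProbabilityMeasure (inputLaw m p μ) := by
  unfold inputLaw; infer_instance

lemma integrable_frobSq_evalRot (h : n ≤ p) (Q : NCPoly m n) (hμ : IsEnsemble μ) :
    Integrable (fun ω => frobSq (Q.evalRot p ω)) (inputLaw m p μ) := by
  have := hμ.isProbabilityMeasure
  have hcont : Continuous fun ω : (Fin m → Mat n) × (Fin m → UGroup p) =>
      frobSq (Q.evalRot p ω) := by
    simp only [← trR_mul_conjTranspose]
    exact continuous_trR.comp (Q.continuous_evalRot.mul Q.continuous_evalRot.matrix_conjTranspose)
  have hdom : Integrable (fun ω : (Fin m → Mat n) × (Fin m → UGroup p) =>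
      p * (∑ S, ‖Q.coeff S‖) ^ 2 * totalGain ω.1 ^ 2) (inputLaw m p μ) :=
    (hμ.integrable_totalGain_sq.comp_fst _).const_mul _
  refine hdom.mono' hcont.aestronglyMeasurable (Filter.Eventually.of_forall fun ω => ?_)
  rw [Real.norm_of_nonneg (frobSq_nonneg _)]
  have h1 : ‖Q.evalRot p ω‖ ≤ 1 * ((∑ S, ‖Q.coeff S‖) * totalGain ω.1) := by
    rw [evalRot_eq, Finset.sum_mul]
    exact opNorm_mul_le_mul (opNorm_incl_le h)
      (norm_sum_le_of_le _ fun S _ => opNorm_rotTerm_le h Q ω S)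
  calc frobSq (Q.evalRot p ω) ≤ p * ‖Q.evalRot p ω‖ ^ 2 := frobSq_le_opNorm _
    _ ≤ p * (1 * ((∑ S, ‖Q.coeff S‖) * totalGain ω.1)) ^ 2 := by gcongr
    _ = _ := by ring

lemma continuous_psi : Continuous psi := by unfold psi; fun_prop

lemma integrable_trR_psi (h : n ≤ p) (Q : NCPoly m n) (hμ : IsEnsemble μ) :
    Integrable (fun ω => 1 / (n : ℝ) * trR (cfc psi (mabs (Q.evalRot p ω) ^ 2)))
      (inputLaw m p μ) := by
  refine Integrable.const_mul ?_ _
  simp only [mabs_sq]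
  refine (Q.integrable_frobSq_evalRot h hμ).mono'
    ((continuous_trR_cfc continuous_psi).comp Q.continuous_evalRot).aestronglyMeasurable
    (Filter.Eventually.of_forall fun ω => ?_)
  rw [Real.norm_of_nonneg (trR_psi_nonneg _), ← trR_mul_conjTranspose]
  exact trR_psi_le_trR (Matrix.posSemidef_self_mul_conjTranspose _)

lemma integrable_trR_sq (h : n ≤ p) (Q : NCPoly m n) (hμ : IsEnsemble μ) :
    Integrable (fun ω => 1 / (n : ℝ) *
        trR ((cfc (fun t : ℝ => max 0 (t - 1)) (mabs (Q.evalRot p ω))) ^ 2))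
      (inputLaw m p μ) := by
  have hcont : Continuous fun A : Mat p =>
      1 / (n : ℝ) * trR ((cfc (fun t : ℝ => max 0 (t - 1)) (mabs A)) ^ 2) := by
    simp only [cfc_mabs_sq]
    exact continuous_const.mul (continuous_trR_cfc (by fun_prop))
  refine (Q.integrable_trR_psi h hμ).mono' (hcont.comp Q.continuous_evalRot).aestronglyMeasurable
    (Filter.Eventually.of_forall fun ω => ?_)
  have h0 : 0 ≤ trR ((cfc (fun t : ℝ => max 0 (t - 1)) (mabs (Q.evalRot p ω))) ^ 2) := by
    rw [cfc_mabs_sq]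
    exact trR_nonneg (posSemidef_cfc fun x _ => sq_nonneg _)
  rw [Real.norm_of_nonneg (mul_nonneg (by positivity) h0), mabs_sq]
  exact mul_le_mul_of_nonneg_left (trR_cfc_mabs_sq_le _) (by positivity)

/-- The majorization bound with `lowGram` in place of the cube. -/
lemma integral_trR_psi_le (hn : 0 < n) (h : n ≤ p) (Q : NCPoly m n)
    (hQ : ∑ S, frobSq (Q.coeff S) ≤ n) (hμ : IsEnsemble μ) {c₂ c₃ : ℝ} (h₂ : 1 ≤ c₂)
    (h₃ : 1 ≤ c₃) (hint : Integrable (fun A : Mat n => (A * Aᴴ) ^ 2) μ)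
    (hc : ‖∫ A, (A * Aᴴ) ^ 2 ∂μ‖ ≤ c₂) :
    ∫ ω, 1 / (n : ℝ) * trR (cfc psi (mabs (Q.evalRot p ω) ^ 2)) ∂(inputLaw m p μ)
      ≤ 1 / (n : ℝ) * trR (cfc psi Q.lowGram)
        + ((n : ℝ) ^ (1 / 2 : ℝ) * (8 * c₂ * c₃) ^ (9 * Q.degree) * Q.maxInfluence ^ (1 / 6 : ℝ)
        + finiteSizeConst m n * (Q.maxInfluence ^ (-(1 / 3) : ℝ) * (p : ℝ) ^ (-(1 / 2) : ℝ))) := by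
  have := hμ.isProbabilityMeasure
  have hn' : (0 : ℝ) < n := by exact_mod_cast hn
  have hτn : Q.maxInfluence ≤ n := Q.maxInfluence_le.trans hQ
  have hτ0 : 0 ≤ Q.maxInfluence := Q.maxInfluence_nonneg
  set K : ℝ := 4 ^ m * (√Q.maxInfluence * √n) with hK
  set D : (Fin m → Mat n) → ℝ := fun G => frobSq (∑ i, Q.coeff {i} * (G i * (G i)ᴴ) *
    (Q.coeff {i})ᴴ - ∑ i, Q.coeff {i} * (Q.coeff {i})ᴴ) with hD
  obtain ⟨hDint, hDle⟩ := hμ.integral_frobSq_sum_sub_le hint hc fun i : Fin m => Q.coeff {i}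
  have hDnn (G : Fin m → Mat n) : 0 ≤ D G := frobSq_nonneg _
  have hDsq : (fun G => √(D G) ^ 2) = D := funext fun G => Real.sq_sqrt (hDnn G)
  have hsm : AEStronglyMeasurable (fun G => √(D G)) (Measure.pi fun _ : Fin m => μ) :=
    Real.continuous_sqrt.comp_aestronglyMeasurable hDint.aestronglyMeasurable
  have hsq : Integrable (fun G => √(D G) ^ 2) (Measure.pi fun _ : Fin m => μ) := by
    rw [hDsq]; exact hDint
  have hsint : Integrable (fun G => √(D G)) (Measure.pi fun _ : Fin m => μ) :=
    ((memLp_two_iff_integrable_sq hsm).mpr hsq).integrable one_le_two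
  have hcint : Integrable (fun H => cornerSize n p H)
      (Measure.pi fun _ : Fin m => haarUnitary p) :=
    integrable_of_continuous continuous_cornerSize
  have hprod : Integrable (fun ω : (Fin m → Mat n) × (Fin m → UGroup p) =>
      totalGain ω.1 ^ 2 * cornerSize n p ω.2) (inputLaw m p μ) :=
    hμ.integrable_totalGain_sq.mul_prod hcint
  have hfst : Integrable (fun ω : (Fin m → Mat n) × (Fin m → UGroup p) => √(D ω.1))
      (inputLaw m p μ) := hsint.comp_fst _
  have hmain : ∫ G, √(D G) ∂(Measure.pi fun _ : Fin m => μ) ≤ √n * √(c₂ * Q.maxInfluence) := by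
    refine (integral_le_sqrt_integral_sq hsm hsq).trans ?_
    rw [hDsq, ← Real.sqrt_mul hn'.le]
    refine Real.sqrt_le_sqrt (hDle.trans ?_)
    calc ∑ i, c₂ * frobSq (Q.coeff {i}) ^ 2
        ≤ ∑ i, c₂ * Q.maxInfluence * frobSq (Q.coeff {i}) := by
          refine Finset.sum_le_sum fun i _ => ?_
          rw [sq, mul_assoc]
          gcongr
          · exact frobSq_nonneg _
          · exact Q.frobSq_coeff_le_maxInfluence (Finset.singleton_nonempty i)
      _ = c₂ * Q.maxInfluence * ∑ i, frobSq (Q.coeff {i}) := by rw [Finset.mul_sum]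
      _ ≤ c₂ * Q.maxInfluence * n := by
          gcongr
          refine le_trans ?_ hQ
          have hlow := sum_card_le_one fun S : Finset (Fin m) => frobSq (Q.coeff S)
          have hsub := Finset.sum_le_sum_of_subset_of_nonneg (f := fun S => frobSq (Q.coeff S))
            (Finset.filter_subset (fun S : Finset (Fin m) => S.card ≤ 1) Finset.univ)
            fun _ _ _ => frobSq_nonneg _
          have := frobSq_nonneg (Q.coeff ∅)
          linarith
      _ = n * (c₂ * Q.maxInfluence) := by ring
  have hcorner : ∫ ω, totalGain ω.1 ^ 2 * cornerSize n p ω.2 ∂(inputLaw m p μ)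
      ≤ (2 + 2 * n) ^ m * ((m + m ^ 2) * n * (√p)⁻¹) := by
    rw [inputLaw, integral_prod_mul (fun G : Fin m → Mat n => totalGain G ^ 2)
      (fun H : Fin m → UGroup p => cornerSize n p H)]
    exact mul_le_mul hμ.integral_totalGain_sq_le (integral_cornerSize_le h)
      (integral_nonneg fun H => cornerSize_nonneg H) (by positivity)
  have hpt (ω : (Fin m → Mat n) × (Fin m → UGroup p)) :
      1 / (n : ℝ) * trR (cfc psi (mabs (Q.evalRot p ω) ^ 2))
        ≤ 1 / (n : ℝ) * trR (cfc psi Q.lowGram)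
          + K * (totalGain ω.1 ^ 2 * cornerSize n p ω.2) + (√n)⁻¹ * √(D ω.1) := by
    have h1 := Q.trR_psi_evalRot_le hn h ω
    have h2 := Q.opNorm_rotGram_sub_le h hQ ω
    rw [lowRotGram_sub_lowGram h] at h1
    exact h1.trans (by gcongr)
  have hIle := integral_mono (Q.integrable_trR_psi h hμ)
    (((integrable_const _).add (hprod.const_mul K)).add (hfst.const_mul (√n)⁻¹)) hpt
  have hIeq : ∫ ω, (1 / (n : ℝ) * trR (cfc psi Q.lowGram)
          + K * (totalGain ω.1 ^ 2 * cornerSize n p ω.2) + (√n)⁻¹ * √(D ω.1)) ∂(inputLaw m p μ)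
      = 1 / (n : ℝ) * trR (cfc psi Q.lowGram)
        + K * ∫ ω, totalGain ω.1 ^ 2 * cornerSize n p ω.2 ∂(inputLaw m p μ)
        + (√n)⁻¹ * ∫ G, √(D G) ∂(Measure.pi fun _ : Fin m => μ) := by
    have hadd : Integrable (fun ω : (Fin m → Mat n) × (Fin m → UGroup p) =>
        1 / (n : ℝ) * trR (cfc psi Q.lowGram) + K * (totalGain ω.1 ^ 2 * cornerSize n p ω.2))
        (inputLaw m p μ) := (integrable_const _).add (hprod.const_mul K)
    rw [integral_add hadd (hfst.const_mul _),
      integral_add (integrable_const _) (hprod.const_mul K), integral_const,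
      integral_const_mul, integral_const_mul]
    have hfstint : ∫ ω, √(D ω.1) ∂(inputLaw m p μ)
        = ∫ G, √(D G) ∂(Measure.pi fun _ : Fin m => μ) := by
      rw [inputLaw, integral_fun_fst (fun G => √(D G))]
      simp
    rw [hfstint]
    simp
  refine hIle.trans (hIeq.trans_le ?_)
  have hE1 : (√(n : ℝ))⁻¹ * ∫ G, √(D G) ∂(Measure.pi fun _ : Fin m => μ)
      ≤ (n : ℝ) ^ (1 / 2 : ℝ) * (8 * c₂ * c₃) ^ (9 * Q.degree)
        * Q.maxInfluence ^ (1 / 6 : ℝ) := by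
    refine le_trans ?_ (Q.sqrt_mul_maxInfluence_le hn hτn h₂ h₃)
    rw [inv_mul_le_iff₀ (Real.sqrt_pos.mpr hn')]
    exact hmain
  have hE2 : K * ∫ ω, totalGain ω.1 ^ 2 * cornerSize n p ω.2 ∂(inputLaw m p μ)
      ≤ finiteSizeConst m n *
        (Q.maxInfluence ^ (-(1 / 3) : ℝ) * (p : ℝ) ^ (-(1 / 2) : ℝ)) := by
    have hp : (p : ℝ) ^ (-(1 / 2) : ℝ) = (√p)⁻¹ := by
      rw [Real.rpow_neg (Nat.cast_nonneg p), ← Real.sqrt_eq_rpow]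
    have hτ := Q.sqrt_maxInfluence_le hτn
    calc _ ≤ K * ((2 + 2 * n) ^ m * ((m + m ^ 2) * n * (√p)⁻¹)) := by gcongr
      _ ≤ (4 ^ m * ((n : ℝ) ^ (5 / 6 : ℝ) * Q.maxInfluence ^ (-(1 / 3) : ℝ) * √n)) *
          ((2 + 2 * n) ^ m * ((m + m ^ 2) * n * (√p)⁻¹)) := by
          rw [hK]; gcongr
      _ = _ := by rw [hp, finiteSizeConst]; ring
  linarith

end Integrals

end NCPoly

end NCMaj

end

theorem mainTheorem4 :
    ∃ C : ℕ → ℕ → ℝ,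
      ∀ (m n p : ℕ), 0 < m → 0 < n → n ≤ p →
      ∀ (Q : NCMaj.NCPoly m n) (μ : Measure (NCMaj.Mat n)) (c₂ c₃ : ℝ),
        NCMaj.IsEnsemble μ →
        1 ≤ c₂ → 1 ≤ c₃ →
        Integrable (fun A : NCMaj.Mat n => (A * Aᴴ) ^ 2) μ →
        ‖∫ A, (A * Aᴴ) ^ 2 ∂μ‖ ≤ c₂ →
        Integrable (fun A : NCMaj.Mat n => (A * Aᴴ) ^ 3) μ →
        ‖∫ A, (A * Aᴴ) ^ 3 ∂μ‖ ≤ c₃ →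
        -- majorization for polynomials with normalized `L²` norm at most one
        (NCMaj.signExp (fun σ => 1 / (n : ℝ) * NCMaj.trR (NCMaj.mabs (Q.evalSign σ) ^ 2)) ≤ 1 →
          Integrable
            (fun ω => 1 / (n : ℝ) *
              NCMaj.trR (cfc NCMaj.psi (NCMaj.mabs (Q.evalRot p ω) ^ 2)))
            (NCMaj.inputLaw m p μ) ∧
          ∫ ω, 1 / (n : ℝ) * NCMaj.trR (cfc NCMaj.psi (NCMaj.mabs (Q.evalRot p ω) ^ 2))
              ∂(NCMaj.inputLaw m p μ)
            ≤ NCMaj.signExp (fun σ =>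
                1 / (n : ℝ) * NCMaj.trR (cfc NCMaj.psi (NCMaj.mabs (Q.evalSign σ) ^ 2)))
              + (n : ℝ) ^ (1 / 2 : ℝ) * (8 * c₂ * c₃) ^ (9 * Q.degree)
                  * Q.maxInfluence ^ (1 / 6 : ℝ)
              + C m n * (Q.maxInfluence ^ (-(1 / 3) : ℝ) * (p : ℝ) ^ (-(1 / 2) : ℝ))) ∧
        -- near-contraction for polynomials that are contractions on the cube
        ((∀ σ, ‖Q.evalSign σ‖ ≤ 1) →
          Integrable
            (fun ω => 1 / (n : ℝ) *
              NCMaj.trR (cfc NCMaj.psi (NCMaj.mabs (Q.evalRot p ω) ^ 2)))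
            (NCMaj.inputLaw m p μ) ∧
          ∫ ω, 1 / (n : ℝ) * NCMaj.trR (cfc NCMaj.psi (NCMaj.mabs (Q.evalRot p ω) ^ 2))
              ∂(NCMaj.inputLaw m p μ)
            ≤ (n : ℝ) ^ (1 / 2 : ℝ) * (8 * c₂ * c₃) ^ (9 * Q.degree)
                  * Q.maxInfluence ^ (1 / 6 : ℝ)
              + C m n * (Q.maxInfluence ^ (-(1 / 3) : ℝ) * (p : ℝ) ^ (-(1 / 2) : ℝ)) ∧
          Integrable
            (fun ω => 1 / (n : ℝ) *
              NCMaj.trR ((cfc (fun t : ℝ => max 0 (t - 1)) (NCMaj.mabs (Q.evalRot p ω))) ^ 2))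
            (NCMaj.inputLaw m p μ) ∧
          ∫ ω, 1 / (n : ℝ) *
              NCMaj.trR ((cfc (fun t : ℝ => max 0 (t - 1)) (NCMaj.mabs (Q.evalRot p ω))) ^ 2)
              ∂(NCMaj.inputLaw m p μ)
            ≤ (n : ℝ) ^ (1 / 2 : ℝ) * (8 * c₂ * c₃) ^ (9 * Q.degree)
                  * Q.maxInfluence ^ (1 / 6 : ℝ)
              + C m n * (Q.maxInfluence ^ (-(1 / 3) : ℝ) * (p : ℝ) ^ (-(1 / 2) : ℝ))) := by
  refine ⟨NCMaj.NCPoly.finiteSizeConst,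
    fun m n p _ hn hp Q μ c₂ c₃ hμ h₂ h₃ hint hc _ _ => ⟨fun hQ => ?_, fun hQ => ?_⟩⟩
  · have hn' : (0 : ℝ) < n := by exact_mod_cast hn
    rw [NCMaj.NCPoly.signExp_mabs_sq, one_div, inv_mul_le_iff₀ hn', mul_one] at hQ
    refine ⟨Q.integrable_trR_psi hp hμ,
      (Q.integral_trR_psi_le hn hp hQ hμ h₂ h₃ hint hc).trans ?_⟩
    rw [← add_assoc, NCMaj.NCPoly.signExp_const_mul]
    simp only [NCMaj.mabs_sq]
    gcongr
    exact Q.trR_psi_lowGram_le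
  · have hzero : NCMaj.trR (cfc NCMaj.psi Q.lowGram) ≤ 0 := by
      refine Q.trR_psi_lowGram_le.trans_eq ?_
      simp only [NCMaj.NCPoly.trR_psi_gram_eq_zero (hQ _)]
      simp [NCMaj.signExp]
    have hcoeff : ∑ S, NCMaj.frobSq (Q.coeff S) ≤ n := by
      have h1 := NCMaj.NCPoly.signExp_trR_mul Q 1
      simp only [mul_one, NCMaj.trR_sum, NCMaj.trR_mul_conjTranspose] at h1
      rw [← h1, NCMaj.signExp, inv_mul_le_iff₀ (by positivity)]
      refine (Finset.sum_le_card_nsmul _ _ (n : ℝ) fun σ _ => ?_).trans_eq ?_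
      · have h2 : ‖Q.evalSign σ‖ ^ 2 ≤ 1 := pow_le_one₀ (norm_nonneg _) (hQ σ)
        have h3 := NCMaj.frobSq_le_opNorm (Q.evalSign σ)
        have h4 : (0 : ℝ) ≤ n := Nat.cast_nonneg n
        nlinarith
      · simp
    have hpsi := Q.integral_trR_psi_le hn hp hcoeff hμ h₂ h₃ hint hc
    have hle : 1 / (n : ℝ) * NCMaj.trR (cfc NCMaj.psi Q.lowGram) ≤ 0 :=
      mul_nonpos_of_nonneg_of_nonpos (by positivity) hzero
    have hpsi' := hpsi.trans (add_le_of_nonpos_left hle)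
    refine ⟨Q.integrable_trR_psi hp hμ, hpsi', Q.integrable_trR_sq hp hμ, le_trans ?_ hpsi'⟩
    refine integral_mono (Q.integrable_trR_sq hp hμ) (Q.integrable_trR_psi hp hμ) fun ω => ?_
    simp only [NCMaj.mabs_sq]
    exact mul_le_mul_of_nonneg_left (NCMaj.trR_cfc_mabs_sq_le _) (by positivity)
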